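/- Let $m$ be Lebesgue measure on $[0,1]$. A symmetric space $X$ is a Banach space of (classes of) real measurable functions on $[0,1]$ such that (i) $|x|\le|y|$ a.e., $y\in X$ imply $x\in X$, $\|x\|_X\le\|y\|_X$; (ii) if $|x|,|y|$ have the same distribution function and $y\in X$, then $x\in X$, $\|x\|_X=\|y\|_X$; (iii) $\|1\|_X=1$. For measurable $f,y$ put $(f\otimes y)(s,t)=f(s)y(t)$ on $[0,1]^2$ and $\|f\otimes y\|_{X(I\times I)}=\|(f\otimes y)^{\circledast}\|_X$, where $^{\circledast}$ is the decreasing rearrangement on $[0,1]$ of the modulus with respect to planar Lebesgue measure. The multiplicator space $\mathscr M(X)$ consists of all $f$ for which $y\mapsto f\otimes y$ is bounded from $X$ to $X(I\times I)$, and $\|f\|_{\mathscr M(X)}$ is its operator norm. Let $V_0f(t)=f(2t)$ on $[0,\frac12]$ and $0$ elsewhere, $V_1f(t)=f(2t-1)$ on $[\frac12,1]$ and $0$ elsewhere, and $V^\alpha f=V_{\alpha_1}\cdots V_{\alpha_k}f$ for $\alpha=(\alpha_1,\dots,\alpha_k)\in\{0,1\}^k$, $|\alpha|=k\ge0$; let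 $\mathbb A=\bigcup_{k\ge0}\{0,1\}^k$. Let $\Xi_k=\mathbb R^{\{0,1\}^k}$ with the norm $\|\xi\|_{\Xi_k}=\bigl\|\sum_{|\alpha|=k}\xi_\alpha V^\alpha 1\bigr\|_X$, and let $\Xi=\bigl(\bigoplus_{k\ge0}\Xi_k\bigr)_{\ell^1}$ be the space of all real families $\xi=(\xi_\alpha)_{\alpha\in\mathbb A}$ with $\|\xi\|_\Xi=\sum_{k\ge 0}\|(\xi_\alpha)_{|\alpha|=k}\|_{\Xi_k}<\infty$. If $\Delta$ is a Banach space of sequences in which the standard unit vectors form a basis, then a sequence $(x_n)$ of nonzero elements of a Banach space $E$ is a frame in $E$ with respect to $\Delta$, with bounds $0<A\le B<\infty$, if for all $y\in E^*$ $$A\|y\|_{E^*}\le\|\{\langle x_n,y\rangle\}_n\|_{\Delta^*}\le B\|y\|_{E^*},\qquad \|\eta\|_{\Delta^*}=\sup_{\|\xi\|_\Delta\le1}\Bigl|\sum_n\xi_n\eta_n\Bigr|.$$ **Theorem.** Let $X$ be a separable symmetric space and let $f\in X$ satisfy $\int_0^1f\,dm\ne0$ and $f\in\mathscr M(X)$.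 Then, for every enumeration of $\mathbb A$ by the natural numbers, $\Xi$ is a Banach space of sequences in which the standard unit vectors form a basis, and the system $\{V^\alpha f\}_{\alpha\in\mathbb A}$ is a frame in $X$ with respect to $\Xi$, with bounds $A=\bigl|\int_0^1f\,dm\bigr|$ and $B=\|f\|_{\mathscr M(X)}$. -/

import Mathlib

open MeasureTheory Filter Topology
open scoped ENNReal

noncomputable section

/-- Lebesgue measure on `[0,1]`, seen as a measure on `ℝ`. -/
def lebI : Measure ℝ := volume.restrict (Set.Icc 0 1)

instance : IsProbabilityMeasure lebI := ⟨by simp [lebI]⟩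

/-- Real-valued Lebesgue measurable functions on `[0,1]`, identified when equal a.e. -/
abbrev L0I : Type := ℝ →ₘ[lebI] ℝ

/-- `x` and `y` are equimeasurable: `|x|` and `|y|` have the same distribution function. -/
def Equimeasurable (x y : L0I) : Prop :=
  ∀ s : ℝ, 0 < s → lebI {u | s < |x u|} = lebI {u | s < |y u|}

/-- A symmetric (rearrangement invariant) Banach function space on `[0,1]`, normalized by
`‖χ_{[0,1]}‖ = 1`. The space and its norm are given together by one extended functional
`nrm`: the space is `{x | nrm x < ∞}`, its norm is `nrm`, and `nrm x = ∞` for `x` outside. -/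
structure SymmetricSpace where
  /-- the norm, with value `∞` outside the space -/
  nrm : L0I → ℝ≥0∞
  eq_zero_of_nrm : ∀ x, nrm x = 0 → x = 0
  nrm_smul : ∀ (c : ℝ) (x), nrm (c • x) = ‖c‖ₑ * nrm x
  nrm_add_le : ∀ x y, nrm (x + y) ≤ nrm x + nrm y
  complete : ∀ u : ℕ → L0I, (∀ n, nrm (u n) < ∞) →
    (∀ ε : ℝ≥0∞, 0 < ε → ∃ N, ∀ m ≥ N, ∀ n ≥ N, nrm (u m - u n) < ε) →
    ∃ l, nrm l < ∞ ∧ Tendsto (fun n => nrm (u n - l)) atTop (𝓝 0)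
  ideal : ∀ x y : L0I, (∀ᵐ t ∂lebI, |x t| ≤ |y t|) → nrm x ≤ nrm y
  symm : ∀ x y : L0I, Equimeasurable x y → nrm x = nrm y
  nrm_one : nrm 1 = 1

namespace SymmetricSpace

variable (X : SymmetricSpace)

theorem nrm_zero : X.nrm 0 = 0 := by
  simpa using X.nrm_smul 0 0

/-- The vector space of the elements of `X`. -/
def toSubmodule : Submodule ℝ L0I where
  carrier := {x | X.nrm x < ∞}
  add_mem' {x y} hx hy := (X.nrm_add_le x y).trans_lt (ENNReal.add_lt_top.2 ⟨hx, hy⟩)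
  zero_mem' := by simp [X.nrm_zero]
  smul_mem' c x hx := by
    simp only [Set.mem_ofPred_eq, X.nrm_smul] at hx ⊢
    exact ENNReal.mul_lt_top (by simp) hx

instance : CoeSort SymmetricSpace Type := ⟨fun X => X.toSubmodule⟩

instance : Norm X := ⟨fun x => (X.nrm x.1).toReal⟩

theorem norm_def (x : X) : ‖x‖ = (X.nrm x.1).toReal := rfl

theorem normedSpaceCore : NormedSpace.Core ℝ X where
  norm_nonneg x := ENNReal.toReal_nonneg
  norm_smul c x := by simp [norm_def, X.nrm_smul]
  norm_triangle x y := by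
    rw [norm_def, norm_def, norm_def, ← ENNReal.toReal_add x.2.ne y.2.ne]
    exact ENNReal.toReal_mono (ENNReal.add_lt_top.2 ⟨x.2, y.2⟩).ne (X.nrm_add_le x.1 y.1)
  norm_eq_zero_iff x := by
    rw [norm_def, ENNReal.toReal_eq_zero_iff]
    constructor
    · rintro (h | h)
      · exact Subtype.ext (X.eq_zero_of_nrm _ h)
      · exact absurd h x.2.ne
    · rintro rfl
      exact Or.inl X.nrm_zero

instance : NormedAddCommGroup X := NormedAddCommGroup.ofCore X.normedSpaceCore

instance : NormedSpace ℝ X := NormedSpace.ofCore X.normedSpaceCore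

theorem ofReal_norm_eq (x : X) : ENNReal.ofReal ‖x‖ = X.nrm x.1 :=
  ENNReal.ofReal_toReal x.2.ne

instance : CompleteSpace X := by
  refine Metric.complete_of_cauchySeq_tendsto fun u hu => ?_
  obtain ⟨l, hl, hlim⟩ := X.complete (fun n => (u n).1) (fun n => (u n).2) (by
    intro ε hε
    obtain ⟨δ, hδ, hδε⟩ := ENNReal.lt_iff_exists_nnreal_btwn.1 hε
    obtain ⟨N, hN⟩ := Metric.cauchySeq_iff.1 hu δ (by exact_mod_cast hδ)
    refine ⟨N, fun m hm n hn => lt_trans ?_ hδε⟩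
    have h := hN m hm n hn
    rw [dist_eq_norm] at h
    have h2 := (ENNReal.ofReal_lt_ofReal_iff_of_nonneg (norm_nonneg _)).2 h
    rw [ofReal_norm_eq] at h2
    simpa using h2)
  refine ⟨⟨l, hl⟩, tendsto_iff_norm_sub_tendsto_zero.2 ?_⟩
  exact (ENNReal.tendsto_toReal ENNReal.zero_ne_top).comp hlim

end SymmetricSpace

/-! ### Decreasing rearrangement, tensor product, multiplicator space -/

/-- The decreasing right-continuous rearrangement of `|g|` with respect to `ν`. -/
def decRearr {β : Type*} [MeasurableSpace β] (ν : Measure β) (g : β → ℝ) (t : ℝ) : ℝ :=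
  sInf {s : ℝ | 0 ≤ s ∧ ν {u | s < |g u|} ≤ ENNReal.ofReal t}

theorem decRearr_aestronglyMeasurable {β : Type*} [MeasurableSpace β] {ν : Measure β}
    [IsFiniteMeasure ν] {g : β → ℝ} (hg : AEStronglyMeasurable g ν) :
    AEStronglyMeasurable (decRearr ν g) lebI := by
  have hne : ∀ t : ℝ, 0 < t →
      {s : ℝ | 0 ≤ s ∧ ν {u | s < |g u|} ≤ ENNReal.ofReal t}.Nonempty := by
    intro t ht
    have hlim : Tendsto (fun n : ℕ => ν {u | (n : ℝ) < |g u|}) atTop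
        (𝓝 (ν (⋂ n : ℕ, {u | (n : ℝ) < |g u|}))) := by
      refine tendsto_measure_iInter_atTop (fun n => ?_) ?_ ⟨0, measure_ne_top _ _⟩
      · exact nullMeasurableSet_lt aemeasurable_const hg.aemeasurable.abs
      · intro m n hmn u hu
        have : (m : ℝ) ≤ n := by exact_mod_cast hmn
        exact lt_of_le_of_lt this hu
    have hempty : (⋂ n : ℕ, {u | (n : ℝ) < |g u|}) = ∅ := by
      ext u
      simp only [Set.mem_iInter, Set.mem_ofPred_eq, Set.mem_empty_iff_false, iff_false, not_forall,
        not_lt]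
      exact exists_nat_ge _
    rw [hempty, measure_empty] at hlim
    obtain ⟨n, hn⟩ := (hlim.eventually_lt_const (ENNReal.ofReal_pos.2 ht)).exists
    exact ⟨n, Nat.cast_nonneg n, hn.le⟩
  have hanti : AntitoneOn (decRearr ν g) (Set.Ioc 0 1) := by
    intro a ha b _ hab
    refine csInf_le_csInf ⟨0, fun s hs => hs.1⟩ (hne a ha.1) ?_
    exact fun s hs => ⟨hs.1, hs.2.trans (ENNReal.ofReal_le_ofReal hab)⟩
  have h := aemeasurable_restrict_of_antitoneOn (μ := volume) measurableSet_Ioc hanti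
  rw [lebI, ← restrict_Ioc_eq_restrict_Icc]
  exact h.aestronglyMeasurable

/-- The rearrangement `x^⊛`, an element of `L0I`, of a measurable function on the square. -/
def rearrSq (x : (ℝ × ℝ) →ₘ[lebI.prod lebI] ℝ) : L0I :=
  AEEqFun.mk (decRearr (lebI.prod lebI) x)
    (decRearr_aestronglyMeasurable x.aestronglyMeasurable)

/-- The norm of `X(I × I)`; the space is the set where it is finite. -/
def SymmetricSpace.nrmSq (X : SymmetricSpace) (x : (ℝ × ℝ) →ₘ[lebI.prod lebI] ℝ) : ℝ≥0∞ :=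
  X.nrm (rearrSq x)

/-- The tensor product `(x ⊗ y)(s,t) = x(s) y(t)`. -/
def tensorI (x y : L0I) : (ℝ × ℝ) →ₘ[lebI.prod lebI] ℝ :=
  x.compQuasiMeasurePreserving Prod.fst Measure.quasiMeasurePreserving_fst *
    y.compQuasiMeasurePreserving Prod.snd Measure.quasiMeasurePreserving_snd

/-- The norm `‖x‖_{𝓜(X)}`: the operator norm of `y ↦ x ⊗ y` from `X` to `X(I × I)`, with value
`∞` if this operator is not bounded (or does not map `X` to `X(I × I)`). -/
def SymmetricSpace.multNrm (X : SymmetricSpace) (x : L0I) : ℝ≥0∞ :=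
  sInf {C : ℝ≥0∞ | ∀ y : L0I, X.nrm y < ∞ → X.nrmSq (tensorI x y) ≤ C * X.nrm y}

/-- The multiplicator space `𝓜(X)`. -/
def SymmetricSpace.multiplicator (X : SymmetricSpace) : Set L0I := {x | X.multNrm x < ∞}

/-! ### Dyadic dilations and translations -/

/-- The map `t ↦ 2t` (for `V₀`, `false`) or `t ↦ 2t - 1` (for `V₁`, `true`). -/
def dyadicMap (a : Bool) (t : ℝ) : ℝ := 2 * t - (if a then 1 else 0)

/-- The left or right half of `[0,1]`. -/
def dyadicHalf (a : Bool) : Set ℝ := if a then Set.Icc (1 / 2) 1 else Set.Icc 0 (1 / 2)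

/-- The operators `V₀` (`a = false`) and `V₁` (`a = true`): `V₀ f (t) = f (2t)` on `[0,1/2]` and
`V₁ f (t) = f (2t - 1)` on `[1/2,1]`, and zero elsewhere. -/
def dyadicV (a : Bool) (f : L0I) : L0I :=
  AEEqFun.mk ((dyadicHalf a).indicator (fun t => f (dyadicMap a t))) (by
    refine StronglyMeasurable.aestronglyMeasurable (StronglyMeasurable.indicator ?_ ?_)
    · exact f.stronglyMeasurable.comp_measurable (by unfold dyadicMap; fun_prop)
    · cases a <;> simp [dyadicHalf])

/-- `V^α f = V_{α₁} ⋯ V_{α_k} f` for a multi-index `α = (α₁, …, α_k)`, a finite list of bits. -/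
def dyadicPow : List Bool → L0I → L0I
  | [], f => f
  | a :: α, f => dyadicV a (dyadicPow α f)

theorem dyadicHalf_eq (a : Bool) : dyadicHalf a = dyadicMap a ⁻¹' Set.Icc 0 1 := by
  ext t
  cases a <;> simp only [dyadicHalf, dyadicMap, Set.mem_preimage, Set.mem_Icc, if_true,
    Bool.false_eq_true, if_false] <;> constructor <;> rintro ⟨h1, h2⟩ <;> constructor <;> linarith

theorem dyadicHalf_subset (a : Bool) : dyadicHalf a ⊆ Set.Icc 0 1 := by
  intro t ht
  cases a <;> simp only [dyadicHalf, Set.mem_Icc, if_true, Bool.false_eq_true, if_false] at ht ⊢ <;>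
    constructor <;> linarith [ht.1, ht.2]

theorem measurable_dyadicMap (a : Bool) : Measurable (dyadicMap a) := by
  unfold dyadicMap; fun_prop

theorem lebI_dyadicMap (a : Bool) {S : Set ℝ} (hS : MeasurableSet S) :
    lebI (dyadicHalf a ∩ dyadicMap a ⁻¹' S) = 2⁻¹ * lebI S := by
  have h1 : dyadicHalf a ∩ dyadicMap a ⁻¹' S ∩ Set.Icc 0 1
      = (fun t => 2 * t) ⁻¹' ((fun t => t + -(if a then 1 else 0)) ⁻¹' (S ∩ Set.Icc 0 1)) := by
    rw [Set.inter_eq_left.2 (Set.inter_subset_left.trans (dyadicHalf_subset a)), dyadicHalf_eq,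
      ← Set.preimage_inter, Set.inter_comm]
    rfl
  have hm : MeasurableSet (dyadicHalf a ∩ dyadicMap a ⁻¹' S) := by
    rw [dyadicHalf_eq]
    exact (measurable_dyadicMap a measurableSet_Icc).inter (measurable_dyadicMap a hS)
  rw [lebI, Measure.restrict_apply hm, Measure.restrict_apply hS, h1,
    Real.volume_preimage_mul_left two_ne_zero, measure_preimage_add_right]
  congr 1
  rw [abs_of_pos (by norm_num), ENNReal.ofReal_inv_of_pos (by norm_num)]
  simp

/-- `V₀` and `V₁` do not increase the norm of a symmetric space. -/
theorem SymmetricSpace.nrm_dyadicV_le (X : SymmetricSpace) (a : Bool) (f : L0I) :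
    X.nrm (dyadicV a f) ≤ X.nrm f := by
  have hf : ∀ b, Measurable fun t => f (dyadicMap b t) := fun b =>
    f.stronglyMeasurable.measurable.comp (measurable_dyadicMap b)
  have hg : Measurable fun t : ℝ => if t ≤ 1 / 2 then f (dyadicMap false t)
      else f (dyadicMap true t) := Measurable.ite measurableSet_Iic (hf false) (hf true)
  set g : ℝ → ℝ := fun t : ℝ => if t ≤ 1 / 2 then f (dyadicMap false t)
      else f (dyadicMap true t) with hgdef
  have hne : ∀ᵐ t ∂lebI, t ≠ 1 / 2 :=
    ae_restrict_of_ae (by simp [ae_iff])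
  have hmem : ∀ᵐ t ∂lebI, t ∈ Set.Icc (0 : ℝ) 1 := ae_restrict_mem measurableSet_Icc
  set G : L0I := AEEqFun.mk g hg.aestronglyMeasurable
  have hG : ∀ᵐ t ∂lebI, G t = g t := AEEqFun.coeFn_mk _ _
  have hV : ∀ᵐ t ∂lebI, dyadicV a f t = (dyadicHalf a).indicator (fun t => f (dyadicMap a t)) t :=
    AEEqFun.coeFn_mk _ _
  have hequi : Equimeasurable G f := by
    intro s _
    have hS : MeasurableSet {u | s < |f u|} :=
      measurableSet_lt measurable_const f.stronglyMeasurable.measurable.abs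
    have e0 : ({u | s < |G u|} ∩ Set.Iic (1 / 2) : Set ℝ) =ᵐ[lebI]
        (dyadicHalf false ∩ dyadicMap false ⁻¹' {u | s < |f u|} : Set ℝ) := by
      filter_upwards [hG, hmem] with t h1 h2
      refine propext ?_
      change (s < |G t| ∧ t ≤ 1 / 2) ↔ (t ∈ dyadicHalf false ∧ s < |f (dyadicMap false t)|)
      rw [h1, hgdef]
      by_cases h : t ≤ 1 / 2
      · simp only [h, dyadicHalf, if_true, Bool.false_eq_true, if_false, Set.mem_Icc, h2.1]
        tauto
      · simp only [h, and_false, dyadicHalf, Bool.false_eq_true, if_false, Set.mem_Icc, false_and]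
    have e1 : ({u | s < |G u|} \ Set.Iic (1 / 2) : Set ℝ) =ᵐ[lebI]
        (dyadicHalf true ∩ dyadicMap true ⁻¹' {u | s < |f u|} : Set ℝ) := by
      filter_upwards [hG, hmem, hne] with t h1 h2 h3
      refine propext ?_
      change (s < |G t| ∧ ¬ t ≤ 1 / 2) ↔ (t ∈ dyadicHalf true ∧ s < |f (dyadicMap true t)|)
      rw [h1, hgdef]
      by_cases h : t ≤ 1 / 2
      · have h4 : ¬ 1 / 2 ≤ t := fun h' => h3 (le_antisymm h h')
        simp only [h, dyadicHalf, if_true, Set.mem_Icc, h4]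
        tauto
      · have h4 : 1 / 2 ≤ t := (not_le.1 h).le
        simp only [h, dyadicHalf, if_true, if_false, Set.mem_Icc, h4, h2.2]
        tauto
    rw [← measure_inter_add_sdiff {u | s < |G u|} (measurableSet_Iic (a := (1 / 2 : ℝ))),
      measure_congr e0, measure_congr e1, lebI_dyadicMap _ hS, lebI_dyadicMap _ hS, ← add_mul,
      ENNReal.inv_two_add_inv_two, one_mul]
  rw [← X.symm G f hequi]
  refine X.ideal _ _ ?_
  filter_upwards [hG, hV, hne] with t h1 h2 h3
  rw [h1, h2]
  by_cases ht : t ∈ dyadicHalf a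
  · rw [Set.indicator_of_mem ht, hgdef]
    cases a
    · have : t ≤ 1 / 2 := by simpa using ht.2
      simp only [this, if_true, le_refl]
    · have h4 : ¬ t ≤ 1 / 2 := fun h => h3 (le_antisymm h ht.1)
      simp only [h4, if_false, le_refl]
  · rw [Set.indicator_of_notMem ht]
    simp

theorem SymmetricSpace.dyadicPow_mem (X : SymmetricSpace) (α : List Bool) (f : X) :
    dyadicPow α f.1 ∈ X.toSubmodule := by
  induction α with
  | nil => exact f.2
  | cons a α ih => exact (X.nrm_dyadicV_le a _).trans_lt ih

/-- `V^α f` as an element of `X`, for `f ∈ X`. -/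
def SymmetricSpace.dyadicElem (X : SymmetricSpace) (f : X) (α : List Bool) : X :=
  ⟨dyadicPow α f.1, X.dyadicPow_mem α f⟩

/-! ### Banach sequence spaces and frames -/

/-- `Δ : (ℕ → ℝ) → [0,∞]` is the norm (with value `∞` outside the space) of a Banach space of
sequences `{ξ | Δ ξ < ∞}` in which the standard unit vectors `δ_n` form a basis: each `ξ` in the
space has a unique norm convergent expansion `∑ c_n δ_n`, and its coefficients are the `ξ_n`. -/
structure IsBasicSequenceSpace (Δ : (ℕ → ℝ) → ℝ≥0∞) : Prop where
  eq_zero_of_nrm : ∀ ξ, Δ ξ = 0 → ξ = 0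
  nrm_smul : ∀ (c : ℝ) (ξ), Δ (c • ξ) = ‖c‖ₑ * Δ ξ
  nrm_add_le : ∀ ξ η, Δ (ξ + η) ≤ Δ ξ + Δ η
  complete : ∀ u : ℕ → ℕ → ℝ, (∀ n, Δ (u n) < ∞) →
    (∀ ε : ℝ≥0∞, 0 < ε → ∃ N, ∀ m ≥ N, ∀ n ≥ N, Δ (u m - u n) < ε) →
    ∃ l, Δ l < ∞ ∧ Tendsto (fun n => Δ (u n - l)) atTop (𝓝 0)
  unit_mem : ∀ n, Δ (Pi.single n 1) < ∞
  basis : ∀ ξ, Δ ξ < ∞ → ∀ c : ℕ → ℝ,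
    Tendsto (fun N => Δ (ξ - ∑ n ∈ Finset.range N, c n • Pi.single n 1)) atTop (𝓝 0) ↔ c = ξ

/-- The norm of `η` in `Δ*`: the supremum of `|∑ ξ_n η_n|` over `Δ ξ ≤ 1`, that is, the least
bound `C` for these numbers; it is `∞` if one of the series does not converge. -/
def seqDualNrm (Δ : (ℕ → ℝ) → ℝ≥0∞) (η : ℕ → ℝ) : ℝ≥0∞ :=
  sInf {C : ℝ≥0∞ | ∀ ξ, Δ ξ ≤ 1 →
    ∃ l : ℝ, Tendsto (fun N => ∑ n ∈ Finset.range N, ξ n * η n) atTop (𝓝 l) ∧ ‖l‖ₑ ≤ C}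

/-- The sequence `x` of nonzero elements of the Banach space `E` is a frame in `E` with respect to
the Banach sequence space `Δ`, with frame bounds `A` and `B`. -/
structure IsFrameWithBounds {E : Type*} [NormedAddCommGroup E] [NormedSpace ℝ E]
    [CompleteSpace E] (Δ : (ℕ → ℝ) → ℝ≥0∞) (x : ℕ → E) (A B : ℝ) : Prop where
  basic : IsBasicSequenceSpace Δ
  ne_zero : ∀ n, x n ≠ 0
  pos : 0 < A
  le : A ≤ B
  lower : ∀ y : StrongDual ℝ E, ENNReal.ofReal (A * ‖y‖) ≤ seqDualNrm Δ (fun n => y (x n))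
  upper : ∀ y : StrongDual ℝ E, seqDualNrm Δ (fun n => y (x n)) ≤ ENNReal.ofReal (B * ‖y‖)

/-- `x` is a frame in `E` with respect to `Δ`. -/
def IsFrame {E : Type*} [NormedAddCommGroup E] [NormedSpace ℝ E]
    [CompleteSpace E] (Δ : (ℕ → ℝ) → ℝ≥0∞) (x : ℕ → E) : Prop :=
  ∃ A B : ℝ, IsFrameWithBounds Δ x A B

namespace SymmetricSpace

/-- The norm of the coordinate space `Ξ_k`, on families `(ξ_α)` indexed by all multi-indices, of
which only those with `|α| = k` are used: `‖∑_{|α| = k} ξ_α V^α 1‖_X`. -/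
def xiNrm (X : SymmetricSpace) (k : ℕ) (ξ : List Bool → ℝ) : ℝ≥0∞ :=
  X.nrm (∑ α : List.Vector Bool k, ξ α.1 • dyadicPow α.1 1)

/-- The norm of the `ℓ¹`-sum `Ξ` of the spaces `Ξ_k`, `k = 0, 1, 2, …`. -/
def xiSumNrm (X : SymmetricSpace) (ξ : List Bool → ℝ) : ℝ≥0∞ := ∑' k : ℕ, X.xiNrm k ξ

/-- The space `Ξ` as a space of sequences, through an enumeration `e` of all multi-indices. -/
def xiSeqNrm (X : SymmetricSpace) (e : ℕ ≃ List Bool) (ξ : ℕ → ℝ) : ℝ≥0∞ :=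
  X.xiSumNrm (fun α => ξ (e.symm α))

end SymmetricSpace

end

/-! ### The operators `V₀`, `V₁` and the two halves of `[0,1]` -/

/-! Write `T` for `doubling`, composition with `t ↦ 2t mod 1`, and `g = ∑_{|α| = k} ξ_α V^α 1` for
the dyadic step function with coefficients `ξ`.

Upper bound. On each dyadic interval of length `2^{-k}` the function `∑_{|α| = k} ξ_α V^α f` is a
compressed copy of `ξ_α f`, so it has the same distribution as `f ⊗ g`
(`equimeasurable_levelSum_rearrSq`). Its norm is therefore at most `‖f‖_{𝓜(X)} ‖ξ‖_{Ξ_k}`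
(`nrm_levelSum_le_multNrm`). Changing the signs of the `ξ_α` turns this into a bound for sums of
absolute values (`sum_enorm_le`), and the `ℓ¹`-sum over `k` yields absolute convergence, whatever
the enumeration.

Lower bound. Let `C` bound the pairings of `(⟨V^α f, y⟩)` with the unit ball of `Ξ`, and let `‖g‖ ≤
1`. The same step function `g` is represented at every level `mi + k` by the coefficients
`ξ_{(α₁,…,α_k)}`. Spreading it with weight `1/N` over the levels `mi + k`, `i < N`, gives a family
in the unit ball of `Ξ`, because the sum of the level norms is at most `N · (1/N)`. Its pairing is
`y` applied to `∑_{|α| = k} ξ_α V^α (N⁻¹ ∑_{i < N} T^{mi} f)`. By a mean ergodic theorem in `X`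
(`exists_nrm_average_sub_lt`) the inner average can be made as close as desired to the constant `∫
f`, so `|∫ f| |y(g)| ≤ C` (`abs_integral_mul_levelElem_le`). Density of dyadic step functions
(`exists_levelSum_near`) gives `|∫ f| ‖y‖ ≤ C`.

Separability enters through order continuity of the norm (`tendsto_nrm_cut`,
`tendsto_nrm_of_dominated`), on which both the density and the ergodic theorem rest. The ergodic
theorem itself is elementary: mean-zero step functions of level `k` have orthogonal iterates under
`T^{k+1}`. -/

theorem measurableSet_dyadicHalf (a : Bool) : MeasurableSet (dyadicHalf a) := by
  rw [dyadicHalf_eq]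
  exact measurable_dyadicMap a measurableSet_Icc

theorem map_dyadicMap_restrict (a : Bool) :
    (lebI.restrict (dyadicHalf a)).map (dyadicMap a) = (2⁻¹ : ℝ≥0∞) • lebI := by
  ext S hS
  rw [Measure.map_apply (measurable_dyadicMap a) hS,
    Measure.restrict_apply (measurable_dyadicMap a hS), Set.inter_comm, lebI_dyadicMap a hS]
  rfl

theorem quasiMeasurePreserving_dyadicMap (a : Bool) :
    Measure.QuasiMeasurePreserving (dyadicMap a) (lebI.restrict (dyadicHalf a)) lebI := by
  refine ⟨measurable_dyadicMap a, ?_⟩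
  rw [map_dyadicMap_restrict]
  exact Measure.smul_absolutelyContinuous

theorem ae_dyadicHalf_ne (a : Bool) {b : Bool} (h : b ≠ a) :
    ∀ᵐ t ∂lebI.restrict (dyadicHalf a), t ∉ dyadicHalf b := by
  have hne : ∀ᵐ t ∂lebI.restrict (dyadicHalf a), t ≠ 1 / 2 :=
    ae_restrict_of_ae (ae_restrict_of_ae (by simp [ae_iff]))
  filter_upwards [hne, ae_restrict_mem (measurableSet_dyadicHalf a)] with t h1 h2 h3
  cases a <;> cases b <;> simp [dyadicHalf] at h h2 h3
  · exact h1 (le_antisymm (by linarith) (by linarith))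
  · exact h1 (le_antisymm (by linarith) (by linarith))

theorem ae_dyadicHalf_union : ∀ᵐ t ∂lebI, t ∈ dyadicHalf false ∪ dyadicHalf true := by
  filter_upwards [show ∀ᵐ t ∂lebI, t ∈ Set.Icc (0 : ℝ) 1 from ae_restrict_mem measurableSet_Icc]
    with t ht
  rcases le_total t (1 / 2) with h | h
  · left; simpa [dyadicHalf] using ⟨ht.1, by simpa using h⟩
  · right; simpa [dyadicHalf] using ⟨by simpa using h, ht.2⟩

theorem lebI_eq_add_restrict :
    lebI = lebI.restrict (dyadicHalf false) + lebI.restrict (dyadicHalf true) := by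
  rw [← Measure.restrict_union₀ _ (measurableSet_dyadicHalf true).nullMeasurableSet,
    Measure.restrict_eq_self_of_ae_mem ae_dyadicHalf_union]
  have := ae_dyadicHalf_ne false (b := true) (by simp)
  rw [ae_restrict_iff' (measurableSet_dyadicHalf false)] at this
  rw [AEDisjoint, measure_eq_zero_iff_ae_notMem]
  filter_upwards [this] with t ht h using ht h.1 h.2

theorem ae_lebI_of_forall_half {p : ℝ → Prop}
    (h : ∀ a, ∀ᵐ t ∂lebI.restrict (dyadicHalf a), p t) : ∀ᵐ t ∂lebI, p t := by
  rw [lebI_eq_add_restrict, ae_add_measure_iff]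
  exact ⟨h false, h true⟩

theorem dyadicV_ae_half (a : Bool) (f : L0I) :
    ∀ᵐ t ∂lebI.restrict (dyadicHalf a), dyadicV a f t = f (dyadicMap a t) := by
  have hV : ∀ᵐ t ∂lebI, dyadicV a f t = (dyadicHalf a).indicator (fun t => f (dyadicMap a t)) t :=
    AEEqFun.coeFn_mk _ _
  filter_upwards [ae_restrict_of_ae hV, ae_restrict_mem (measurableSet_dyadicHalf a)] with t h1 h2
  rw [h1, Set.indicator_of_mem h2]

theorem dyadicV_ae_half_ne {a b : Bool} (h : b ≠ a) (f : L0I) :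
    ∀ᵐ t ∂lebI.restrict (dyadicHalf a), dyadicV b f t = 0 := by
  have hV : ∀ᵐ t ∂lebI, dyadicV b f t = (dyadicHalf b).indicator (fun t => f (dyadicMap b t)) t :=
    AEEqFun.coeFn_mk _ _
  filter_upwards [ae_restrict_of_ae hV, ae_dyadicHalf_ne a h] with t h1 h2
  rw [h1, Set.indicator_of_notMem h2]

theorem dyadicV_eq_zero {a : Bool} {f : L0I} (h : dyadicV a f = 0) : f = 0 := by
  have h0 : ∀ᵐ t ∂lebI, dyadicV a f t = 0 := by
    rw [h]; exact AEEqFun.coeFn_zero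
  have h1 : ∀ᵐ t ∂lebI.restrict (dyadicHalf a), f (dyadicMap a t) = 0 := by
    filter_upwards [ae_restrict_of_ae h0, dyadicV_ae_half a f] with t h1 h2
    rw [← h2, h1]
  have hS : MeasurableSet {t | f t = 0} :=
    f.stronglyMeasurable.measurable (measurableSet_singleton 0)
  rw [← ae_map_iff (measurable_dyadicMap a).aemeasurable hS, map_dyadicMap_restrict,
    Measure.ae_ennreal_smul_measure_iff (by simp)] at h1
  refine AEEqFun.ext ?_
  filter_upwards [h1, AEEqFun.coeFn_zero (α := ℝ) (μ := lebI) (β := ℝ)] with t h1 h2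
  rw [h1, h2]; rfl

theorem dyadicPow_eq_zero {α : List Bool} {f : L0I} (h : dyadicPow α f = 0) : f = 0 := by
  induction α with
  | nil => exact h
  | cons a α ih => exact ih (dyadicV_eq_zero h)

/-! ### Gluing two functions along the halves of `[0,1]`. -/

/-- The function equal to `u false (2t)` on the left half and to `u true (2t - 1)` on the right
half of `[0,1]`. -/
noncomputable def dyadicJoin (u : Bool → L0I) : L0I :=
  dyadicV false (u false) + dyadicV true (u true)

theorem dyadicJoin_ae_half (u : Bool → L0I) (a : Bool) :
    ∀ᵐ t ∂lebI.restrict (dyadicHalf a), dyadicJoin u t = u a (dyadicMap a t) := by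
  have h := ae_restrict_of_ae (s := dyadicHalf a)
    (AEEqFun.coeFn_add (dyadicV false (u false)) (dyadicV true (u true)))
  cases a
  · filter_upwards [h, dyadicV_ae_half false (u false),
      dyadicV_ae_half_ne (show true ≠ false by simp) (u true)] with t h1 h2 h3
    rw [dyadicJoin, h1, Pi.add_apply, h2, h3, add_zero]
  · filter_upwards [h, dyadicV_ae_half true (u true),
      dyadicV_ae_half_ne (show false ≠ true by simp) (u false)] with t h1 h2 h3
    rw [dyadicJoin, h1, Pi.add_apply, h2, h3, zero_add]

theorem dyadicJoin_ext {u : Bool → L0I} {v : L0I}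
    (h : ∀ a, ∀ᵐ t ∂lebI.restrict (dyadicHalf a), u a (dyadicMap a t) = v t) : dyadicJoin u = v := by
  refine AEEqFun.ext (ae_lebI_of_forall_half fun a => ?_)
  filter_upwards [h a, dyadicJoin_ae_half u a] with t h1 h2
  rw [h2, h1]

theorem dyadicJoin_add (u v : Bool → L0I) :
    dyadicJoin (fun a => u a + v a) = dyadicJoin u + dyadicJoin v := by
  refine dyadicJoin_ext fun a => ?_
  filter_upwards [(quasiMeasurePreserving_dyadicMap a).ae (AEEqFun.coeFn_add (u a) (v a)),
    ae_restrict_of_ae (AEEqFun.coeFn_add (dyadicJoin u) (dyadicJoin v)), dyadicJoin_ae_half u a,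
    dyadicJoin_ae_half v a]
    with t h1 h2 h3 h4
  rw [h1, h2, Pi.add_apply, Pi.add_apply, h3, h4]

theorem dyadicJoin_mul (u v : Bool → L0I) :
    dyadicJoin (fun a => u a * v a) = dyadicJoin u * dyadicJoin v := by
  refine dyadicJoin_ext fun a => ?_
  filter_upwards [(quasiMeasurePreserving_dyadicMap a).ae (AEEqFun.coeFn_mul (u a) (v a)),
    ae_restrict_of_ae (AEEqFun.coeFn_mul (dyadicJoin u) (dyadicJoin v)), dyadicJoin_ae_half u a,
    dyadicJoin_ae_half v a]
    with t h1 h2 h3 h4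
  rw [h1, h2, Pi.mul_apply, Pi.mul_apply, h3, h4]

theorem dyadicJoin_smul (c : ℝ) (u : Bool → L0I) :
    dyadicJoin (fun a => c • u a) = c • dyadicJoin u := by
  refine dyadicJoin_ext fun a => ?_
  filter_upwards [(quasiMeasurePreserving_dyadicMap a).ae (AEEqFun.coeFn_smul c (u a)),
    ae_restrict_of_ae (AEEqFun.coeFn_smul c (dyadicJoin u)), dyadicJoin_ae_half u a]
    with t h1 h2 h3
  rw [h1, h2, Pi.smul_apply, Pi.smul_apply, h3]

theorem dyadicJoin_one : dyadicJoin (fun _ => 1) = 1 := by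
  refine dyadicJoin_ext fun a => ?_
  filter_upwards [(quasiMeasurePreserving_dyadicMap a).ae
    (AEEqFun.coeFn_one (α := ℝ) (μ := lebI) (β := ℝ)),
    ae_restrict_of_ae (AEEqFun.coeFn_one (α := ℝ) (μ := lebI) (β := ℝ))] with t h1 h2
  rw [h1, h2]; rfl

theorem dyadicV_eq_dyadicJoin (a : Bool) (f : L0I) :
    dyadicV a f = dyadicJoin (fun b => if b = a then f else 0) := by
  symm
  refine dyadicJoin_ext fun b => ?_
  by_cases h : b = a
  · subst h
    filter_upwards [dyadicV_ae_half b f] with t ht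
    simp [ht]
  · filter_upwards [dyadicV_ae_half_ne (Ne.symm h) f, (quasiMeasurePreserving_dyadicMap b).ae
      (AEEqFun.coeFn_zero (α := ℝ) (μ := lebI) (β := ℝ))] with t ht h2
    rw [if_neg h, h2, ht]; rfl

theorem dyadicV_add (a : Bool) (f g : L0I) : dyadicV a (f + g) = dyadicV a f + dyadicV a g := by
  simp only [dyadicV_eq_dyadicJoin, ← dyadicJoin_add]
  congr 1; ext1 b; split_ifs <;> simp

theorem dyadicV_smul (a : Bool) (c : ℝ) (f : L0I) : dyadicV a (c • f) = c • dyadicV a f := by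
  simp only [dyadicV_eq_dyadicJoin, ← dyadicJoin_smul]
  congr 1; ext1 b; split_ifs <;> simp

theorem dyadicV_zero (a : Bool) : dyadicV a 0 = 0 := by
  simpa using dyadicV_smul a 0 0

theorem dyadicV_sum {ι : Type*} (s : Finset ι) (a : Bool) (f : ι → L0I) :
    dyadicV a (∑ i ∈ s, f i) = ∑ i ∈ s, dyadicV a (f i) := by
  classical
  induction s using Finset.induction_on with
  | empty => simpa using dyadicV_zero a
  | insert i s hi ih => rw [Finset.sum_insert hi, Finset.sum_insert hi, dyadicV_add, ih]

theorem dyadicJoin_rel {r : ℝ → ℝ → Prop} {u v : Bool → L0I}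
    (h : ∀ a, ∀ᵐ t ∂lebI, r (u a t) (v a t)) :
    ∀ᵐ t ∂lebI, r (dyadicJoin u t) (dyadicJoin v t) := by
  refine ae_lebI_of_forall_half fun a => ?_
  filter_upwards [(quasiMeasurePreserving_dyadicMap a).ae (h a), dyadicJoin_ae_half u a,
    dyadicJoin_ae_half v a] with t h1 h2 h3
  rw [h2, h3]; exact h1

/-- Each half carries the image of the measure with weight `1/2`. With `H` the indicator of `{r | s
< |r|}` this is the recursion for distribution functions. -/
theorem lintegral_dyadicJoin {H : ℝ → ℝ≥0∞} (hH : Measurable H) (u : Bool → L0I) :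
    ∫⁻ t, H (dyadicJoin u t) ∂lebI =
      2⁻¹ * ∫⁻ t, H (u false t) ∂lebI + 2⁻¹ * ∫⁻ t, H (u true t) ∂lebI := by
  have key : ∀ a, ∫⁻ t, H (dyadicJoin u t) ∂lebI.restrict (dyadicHalf a) =
      2⁻¹ * ∫⁻ t, H (u a t) ∂lebI := by
    intro a
    rw [lintegral_congr_ae (g := fun t => H (u a (dyadicMap a t)))
      ((dyadicJoin_ae_half u a).mono fun t ht => by rw [ht]),
      ← lintegral_map (f := fun s => H (u a s)) (hH.comp (u a).stronglyMeasurable.measurable)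
        (measurable_dyadicMap a), map_dyadicMap_restrict, lintegral_smul_measure]
    rfl
  rw [← key, ← key, ← lintegral_add_measure]
  exact congrArg (fun μ : Measure ℝ => ∫⁻ t, H (dyadicJoin u t) ∂μ) lebI_eq_add_restrict

theorem integrable_dyadicJoin {u : Bool → L0I} (hu : ∀ a, Integrable (u a) lebI) :
    Integrable (dyadicJoin u) lebI := by
  have key : ∀ a, Integrable (dyadicJoin u) (lebI.restrict (dyadicHalf a)) := by
    intro a
    refine Integrable.congr ?_ ((dyadicJoin_ae_half u a).mono fun t ht => ht.symm)
    have : Integrable (u a) ((lebI.restrict (dyadicHalf a)).map (dyadicMap a)) := by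
      rw [map_dyadicMap_restrict]
      exact (hu a).smul_measure (by simp)
    exact this.comp_measurable (measurable_dyadicMap a)
  have h := (key false).add_measure (key true)
  rwa [← lebI_eq_add_restrict] at h

theorem integral_dyadicJoin {u : Bool → L0I} (hu : ∀ a, Integrable (u a) lebI) :
    ∫ t, dyadicJoin u t ∂lebI = 2⁻¹ * ∫ t, u false t ∂lebI + 2⁻¹ * ∫ t, u true t ∂lebI := by
  have key : ∀ a, ∫ t, dyadicJoin u t ∂lebI.restrict (dyadicHalf a) = 2⁻¹ * ∫ t, u a t ∂lebI := by
    intro a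
    rw [integral_congr_ae (g := fun t => u a (dyadicMap a t)) (dyadicJoin_ae_half u a),
      ← integral_map (f := u a) (measurable_dyadicMap a).aemeasurable
        (u a).stronglyMeasurable.aestronglyMeasurable, map_dyadicMap_restrict,
      integral_smul_measure]
    simp
  have hi := integrable_dyadicJoin hu
  rw [← key, ← key, ← integral_add_measure hi.restrict hi.restrict]
  exact congrArg (fun μ : Measure ℝ => ∫ t, dyadicJoin u t ∂μ) lebI_eq_add_restrict

/-! ### Sums over all multi-indices of a given length -/

/-- `∑_{|α| = k} ξ_α V^α f`. -/
noncomputable def levelSum : ℕ → (List Bool → ℝ) → L0I → L0I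
  | 0, ξ, f => ξ [] • f
  | k + 1, ξ, f => dyadicJoin fun a => levelSum k (fun α => ξ (a :: α)) f

/-- The recursive definition splits off the first letter of `α`, so that facts about `dyadicJoin`
lift to level `k` by induction; the explicit sum is needed for linearity in `ξ` and for the norm of
`Ξ_k`. -/
theorem levelSum_eq_sum (k : ℕ) (ξ : List Bool → ℝ) (f : L0I) :
    levelSum k ξ f = ∑ α : List.Vector Bool k, ξ α.1 • dyadicPow α.1 f := by
  induction k generalizing ξ with
  | zero =>
    rw [Fintype.sum_eq_single List.Vector.nil fun α h => absurd (Subsingleton.elim α _) h]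
    rfl
  | succ k ih =>
    have e1 : ∑ α : List.Vector Bool (k + 1), ξ α.1 • dyadicPow α.1 f =
        ∑ p : Bool × List.Vector Bool k, ξ (p.1 :: p.2.1) • dyadicPow (p.1 :: p.2.1) f := by
      symm
      refine Fintype.sum_bijective (fun p : Bool × List.Vector Bool k => p.1 ::ᵥ p.2)
        ⟨?_, ?_⟩ _ _ ?_
      · rintro ⟨a, v⟩ ⟨b, w⟩ h
        have h1 := congrArg List.Vector.head h
        have h2 := congrArg List.Vector.tail h
        simp only [List.Vector.head_cons, List.Vector.tail_cons] at h1 h2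
        rw [h1, h2]
      · intro v
        exact ⟨(v.head, v.tail), by simp⟩
      · rintro ⟨a, ⟨l, hl⟩⟩
        rfl
    rw [e1, Fintype.sum_prod_type, Fintype.sum_bool]
    simp only [levelSum, ih, dyadicJoin, dyadicPow, dyadicV_sum, dyadicV_smul]
    exact add_comm _ _

theorem SymmetricSpace.xiNrm_eq (X : SymmetricSpace) (k : ℕ) (ξ : List Bool → ℝ) :
    X.xiNrm k ξ = X.nrm (levelSum k ξ 1) := by
  rw [levelSum_eq_sum]; rfl

theorem levelSum_add_right (k : ℕ) (ξ : List Bool → ℝ) (f g : L0I) :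
    levelSum k ξ (f + g) = levelSum k ξ f + levelSum k ξ g := by
  induction k generalizing ξ with
  | zero => simp [levelSum]
  | succ k ih => simp only [levelSum, ih, dyadicJoin_add]

theorem levelSum_smul_right (k : ℕ) (ξ : List Bool → ℝ) (c : ℝ) (f : L0I) :
    levelSum k ξ (c • f) = c • levelSum k ξ f := by
  induction k generalizing ξ with
  | zero => simp [levelSum, smul_comm c]
  | succ k ih => simp only [levelSum, ih, dyadicJoin_smul]

theorem levelSum_add_left (k : ℕ) (ξ η : List Bool → ℝ) (f : L0I) :
    levelSum k (ξ + η) f = levelSum k ξ f + levelSum k η f := by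
  simp only [levelSum_eq_sum, Pi.add_apply, add_smul, Finset.sum_add_distrib]

theorem levelSum_smul_left (k : ℕ) (c : ℝ) (ξ : List Bool → ℝ) (f : L0I) :
    levelSum k (c • ξ) f = c • levelSum k ξ f := by
  simp only [levelSum_eq_sum, Pi.smul_apply, smul_eq_mul, mul_smul, Finset.smul_sum]

theorem levelSum_congr {k : ℕ} {ξ η : List Bool → ℝ} (h : ∀ α, α.length = k → ξ α = η α)
    (f : L0I) : levelSum k ξ f = levelSum k η f := by
  simp only [levelSum_eq_sum]
  exact Finset.sum_congr rfl fun α _ => by rw [h _ α.2]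

theorem abs_levelSum_le {k : ℕ} {ξ η : List Bool → ℝ} (h : ∀ α, α.length = k → |ξ α| ≤ |η α|)
    (f : L0I) : ∀ᵐ t ∂lebI, |levelSum k ξ f t| ≤ |levelSum k η f t| := by
  induction k generalizing ξ η with
  | zero =>
    filter_upwards [AEEqFun.coeFn_smul (ξ []) f, AEEqFun.coeFn_smul (η []) f] with t h1 h2
    simp only [levelSum, h1, h2, Pi.smul_apply, smul_eq_mul, abs_mul]
    exact mul_le_mul_of_nonneg_right (h _ rfl) (abs_nonneg _)
  | succ k ih =>
    exact dyadicJoin_rel (r := fun x y => |x| ≤ |y|) fun a => ih fun α hα => h _ (by simp [hα])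

/-- A crude triangle inequality. It suffices for finiteness and for limits in which the level and
the coefficients stay fixed or only finitely many levels occur. -/
theorem nrm_levelSum_le (X : SymmetricSpace) (k : ℕ) (ξ : List Bool → ℝ) (f : L0I) :
    X.nrm (levelSum k ξ f) ≤ (∑ α : List.Vector Bool k, ‖ξ α.1‖ₑ) * X.nrm f := by
  have hpow : ∀ α : List Bool, X.nrm (dyadicPow α f) ≤ X.nrm f := by
    intro α
    induction α with
    | nil => exact le_rfl
    | cons a α ih => exact (X.nrm_dyadicV_le a _).trans ih
  have hsum : ∀ (s : Finset (List.Vector Bool k)) (u : List.Vector Bool k → L0I),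
      X.nrm (∑ α ∈ s, u α) ≤ ∑ α ∈ s, X.nrm (u α) := by
    intro s u
    exact Finset.le_sum_of_subadditive X.nrm X.nrm_zero.le X.nrm_add_le s u
  rw [levelSum_eq_sum, Finset.sum_mul]
  refine (hsum _ _).trans (Finset.sum_le_sum fun α _ => ?_)
  rw [X.nrm_smul]
  gcongr
  exact hpow _

/-! ### The doubling map. -/

/-- The operator `f ↦ f(2t mod 1)`. -/
noncomputable def doubling (f : L0I) : L0I := dyadicJoin fun _ => f

theorem doubling_iterate_one (j : ℕ) : doubling^[j] 1 = 1 :=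
  Function.iterate_fixed dyadicJoin_one j

theorem doubling_iterate_add (j : ℕ) (f g : L0I) :
    doubling^[j] (f + g) = doubling^[j] f + doubling^[j] g := by
  induction j with
  | zero => rfl
  | succ j ih => simp only [Function.iterate_succ_apply', ih, doubling, dyadicJoin_add]

theorem doubling_iterate_smul (j : ℕ) (c : ℝ) (f : L0I) :
    doubling^[j] (c • f) = c • doubling^[j] f := by
  induction j with
  | zero => rfl
  | succ j ih => simp only [Function.iterate_succ_apply', ih, doubling, dyadicJoin_smul]

theorem doubling_iterate_mul (j : ℕ) (f g : L0I) :
    doubling^[j] (f * g) = doubling^[j] f * doubling^[j] g := by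
  induction j with
  | zero => rfl
  | succ j ih => simp only [Function.iterate_succ_apply', ih, doubling, dyadicJoin_mul]

theorem equimeasurable_doubling (f : L0I) : Equimeasurable (doubling f) f := by
  intro s _
  have hm : MeasurableSet {r : ℝ | s < |r|} := measurableSet_lt measurable_const measurable_id.abs
  have hl : ∀ g : L0I, lebI {u | s < |g u|} =
      ∫⁻ t, {r : ℝ | s < |r|}.indicator 1 (g t) ∂lebI := by
    intro g
    exact (lintegral_indicator_one (g.stronglyMeasurable.measurable hm)).symm
  rw [hl, hl, doubling, lintegral_dyadicJoin (measurable_one.indicator hm), ← add_mul,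
    ENNReal.inv_two_add_inv_two, one_mul]

theorem nrm_doubling_iterate (X : SymmetricSpace) (j : ℕ) (f : L0I) :
    X.nrm (doubling^[j] f) = X.nrm f := by
  induction j with
  | zero => rfl
  | succ j ih =>
    rw [Function.iterate_succ_apply', X.symm _ _ (equimeasurable_doubling _), ih]

theorem levelSum_const (j : ℕ) (c : ℝ) (f : L0I) :
    levelSum j (fun _ => c) f = c • doubling^[j] f := by
  induction j with
  | zero => rfl
  | succ j ih => simp only [levelSum, ih, Function.iterate_succ_apply', doubling, dyadicJoin_smul]

/-- When the coefficients ignore the last `j` letters, the `2^j` small copies of `f` inside one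
interval of level `k` carry the same coefficient and together form a copy of `T^j f`. This lets one
step function be tested at many levels. -/
theorem levelSum_take (j k : ℕ) (ξ : List Bool → ℝ) (f : L0I) :
    levelSum (j + k) (fun α => ξ (α.take k)) f = levelSum k ξ (doubling^[j] f) := by
  induction k generalizing ξ with
  | zero => simp only [List.take_zero, Nat.add_zero, levelSum_const, levelSum]
  | succ k ih =>
    change levelSum (j + k + 1) _ f = _
    simp only [levelSum, List.take_succ_cons]
    congr 1; ext1 a
    exact ih fun α => ξ (a :: α)

/-- On every dyadic interval of level `k` the function `T^k v` is a compressed copy of `v`, and the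
step function is constant there. -/
theorem levelSum_one_mul (k : ℕ) (ξ : List Bool → ℝ) (v : L0I) :
    levelSum k ξ 1 * doubling^[k] v = levelSum k ξ v := by
  induction k generalizing ξ with
  | zero =>
    refine AEEqFun.ext ?_
    simp only [levelSum, Function.iterate_zero, id_eq]
    filter_upwards [AEEqFun.coeFn_mul (ξ [] • 1) v, AEEqFun.coeFn_smul (ξ []) (1 : L0I),
      AEEqFun.coeFn_smul (ξ []) v, AEEqFun.coeFn_one (α := ℝ) (μ := lebI) (β := ℝ)]
      with t h1 h2 h3 h4
    simp [h1, h2, h3, h4]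
  | succ k ih => simp only [levelSum, Function.iterate_succ_apply', doubling, ← dyadicJoin_mul, ih]

theorem integrable_levelSum (k : ℕ) (ξ : List Bool → ℝ) {v : L0I} (hv : Integrable v lebI) :
    Integrable (levelSum k ξ v) lebI := by
  induction k generalizing ξ with
  | zero => exact (hv.smul (ξ [])).congr (AEEqFun.coeFn_smul (ξ []) v).symm
  | succ k ih => exact integrable_dyadicJoin fun a => ih _

theorem integrable_one_L0I : Integrable (1 : L0I) lebI :=
  (integrable_const (1 : ℝ)).congr AEEqFun.coeFn_one.symm

theorem integral_one_L0I : ∫ t, (1 : L0I) t ∂lebI = 1 := by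
  rw [integral_congr_ae AEEqFun.coeFn_one]
  simp

/-- With `levelSum_one_mul`, this is the independence of the first `k` binary digits from the later
ones. -/
theorem integral_levelSum (k : ℕ) (ξ : List Bool → ℝ) {v : L0I} (hv : Integrable v lebI) :
    ∫ t, levelSum k ξ v t ∂lebI = (∫ t, levelSum k ξ 1 t ∂lebI) * ∫ t, v t ∂lebI := by
  induction k generalizing ξ with
  | zero =>
    simp only [levelSum]
    rw [integral_congr_ae (AEEqFun.coeFn_smul (ξ []) v),
      integral_congr_ae (AEEqFun.coeFn_smul (ξ []) 1)]
    simp only [Pi.smul_apply, integral_smul, integral_one_L0I]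
    simp
  | succ k ih =>
    simp only [levelSum]
    rw [integral_dyadicJoin fun a => integrable_levelSum k _ hv,
      integral_dyadicJoin fun a => integrable_levelSum k _ integrable_one_L0I, ih, ih]
    ring

theorem integral_doubling_iterate (j : ℕ) {v : L0I} (hv : Integrable v lebI) :
    ∫ t, (doubling^[j] v) t ∂lebI = ∫ t, v t ∂lebI := by
  have h := integral_levelSum j (fun _ => 1) hv
  rwa [levelSum_const, levelSum_const, one_smul, one_smul, doubling_iterate_one, integral_one_L0I,
    one_mul] at h

/-! ### Distribution functions of rearrangements and tensor products -/

/-- The distribution function is right continuous, so the infimum defining the rearrangement exceeds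
`s` exactly when `s` itself fails the defining inequality. -/
theorem lt_decRearr_iff {β : Type*} [MeasurableSpace β] {ν : Measure β} [IsFiniteMeasure ν]
    {z : β → ℝ} (hz : AEMeasurable z ν) {s t : ℝ} (hs : 0 ≤ s) (ht : 0 < t) :
    s < decRearr ν z t ↔ ENNReal.ofReal t < ν {u | s < |z u|} := by
  have hbdd : BddBelow {s : ℝ | 0 ≤ s ∧ ν {u | s < |z u|} ≤ ENNReal.ofReal t} :=
    ⟨0, fun _ h => h.1⟩
  refine ⟨fun h => ?_, fun h => ?_⟩
  · by_contra h'
    exact absurd h (not_lt.2 (csInf_le hbdd ⟨hs, not_lt.1 h'⟩))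
  · have hlim : Tendsto (fun n : ℕ => ν {u | s + 1 / ((n : ℝ) + 1) < |z u|}) atTop
        (𝓝 (ν (⋃ n : ℕ, {u | s + 1 / ((n : ℝ) + 1) < |z u|}))) := by
      refine tendsto_measure_iUnion_atTop fun m n hmn u hu => ?_
      exact lt_of_le_of_lt (by gcongr) (show s + 1 / ((m : ℝ) + 1) < |z u| from hu)
    have hU : (⋃ n : ℕ, {u | s + 1 / ((n : ℝ) + 1) < |z u|}) = {u | s < |z u|} := by
      ext u
      simp only [Set.mem_iUnion, Set.mem_ofPred_eq]
      refine ⟨fun ⟨n, hn⟩ => lt_trans (by linarith [Nat.one_div_pos_of_nat (α := ℝ) (n := n)]) hn,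
        fun hu => ?_⟩
      obtain ⟨n, hn⟩ := exists_nat_one_div_lt (sub_pos.2 hu)
      exact ⟨n, by linarith⟩
    rw [hU] at hlim
    obtain ⟨n, hn⟩ := (hlim.eventually_const_lt h).exists
    refine lt_of_lt_of_le (b := s + 1 / ((n : ℝ) + 1))
      (by linarith [Nat.one_div_pos_of_nat (α := ℝ) (n := n)]) (le_csInf ?_ fun r hr => ?_)
    -- The set under the infimum must be nonempty, as `sInf ∅ = 0` in `ℝ`. For `t > 0` it is,
    -- because `z` is finite valued and `ν` is finite.
    · have hlim : Tendsto (fun n : ℕ => ν {u | (n : ℝ) < |z u|}) atTop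
          (𝓝 (ν (⋂ n : ℕ, {u | (n : ℝ) < |z u|}))) := by
        refine tendsto_measure_iInter_atTop (fun n => ?_) ?_ ⟨0, measure_ne_top _ _⟩
        · exact nullMeasurableSet_lt aemeasurable_const hz.abs
        · intro m n hmn u hu
          exact lt_of_le_of_lt (Nat.cast_le.2 hmn) (show (n : ℝ) < |z u| from hu)
      have hempty : (⋂ n : ℕ, {u | (n : ℝ) < |z u|}) = ∅ := by
        ext u
        simpa using exists_nat_ge |z u|
      rw [hempty, measure_empty] at hlim
      obtain ⟨n, hn⟩ := (hlim.eventually_lt_const (ENNReal.ofReal_pos.2 ht)).exists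
      exact ⟨n, Nat.cast_nonneg n, hn.le⟩
    · by_contra hlt
      refine absurd (hn.trans_le (measure_mono fun u hu => ?_)) (not_lt.2 hr.2)
      exact lt_trans (not_le.1 hlt) (show s + 1 / ((n : ℝ) + 1) < |z u| from hu)

/-- Up to a null set, `{x^⊛ > s}` is the interval `(0, d)`, where `d` is the measure of `{|x| > s}`.
-/
theorem lebI_rearrSq (z : (ℝ × ℝ) →ₘ[lebI.prod lebI] ℝ) {s : ℝ} (hs : 0 ≤ s) :
    lebI {t | s < |rearrSq z t|} = (lebI.prod lebI) {p | s < |z p|} := by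
  set d := (lebI.prod lebI) {p | s < |z p|} with hd
  have hd1 : d ≤ 1 := prob_le_one
  have hmem : ∀ᵐ t ∂lebI, t ∈ Set.Ioc (0 : ℝ) 1 := by
    rw [lebI, ← restrict_Ioc_eq_restrict_Icc]
    exact ae_restrict_mem measurableSet_Ioc
  have hr : ∀ᵐ t ∂lebI, rearrSq z t = decRearr (lebI.prod lebI) z t := AEEqFun.coeFn_mk _ _
  have e : ({t | s < |rearrSq z t|} : Set ℝ) =ᵐ[lebI] Set.Ioo 0 d.toReal := by
    filter_upwards [hmem, hr] with t h1 h2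
    refine propext ?_
    change s < |rearrSq z t| ↔ 0 < t ∧ t < d.toReal
    have h0 : 0 ≤ decRearr (lebI.prod lebI) z t := Real.sInf_nonneg fun _ h => h.1
    rw [h2, abs_of_nonneg h0,
      lt_decRearr_iff z.stronglyMeasurable.measurable.aemeasurable hs h1.1, ← hd,
      ENNReal.ofReal_lt_iff_lt_toReal h1.1.le (ne_top_of_le_ne_top ENNReal.one_ne_top hd1)]
    exact ⟨fun h => ⟨h1.1, h⟩, fun h => h.2⟩
  have hsub : Set.Ioo 0 d.toReal ⊆ Set.Icc (0 : ℝ) 1 := fun t ht =>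
    ⟨ht.1.le, ht.2.le.trans (by simpa using ENNReal.toReal_mono ENNReal.one_ne_top hd1)⟩
  rw [measure_congr e, lebI, Measure.restrict_apply measurableSet_Ioo, Set.inter_eq_left.2 hsub,
    Real.volume_Ioo, sub_zero, ENNReal.ofReal_toReal (ne_top_of_le_ne_top ENNReal.one_ne_top hd1)]

theorem prod_tensorI (f g : L0I) (s : ℝ) :
    (lebI.prod lebI) {p | s < |tensorI f g p|} =
      ∫⁻ v, lebI {u | s < |g v * f u|} ∂lebI := by
  have h1 := AEEqFun.coeFn_mul
    (f.compQuasiMeasurePreserving Prod.fst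
      (Measure.quasiMeasurePreserving_fst (μ := lebI) (ν := lebI)))
    (g.compQuasiMeasurePreserving Prod.snd
      (Measure.quasiMeasurePreserving_snd (μ := lebI) (ν := lebI)))
  have h2 := AEEqFun.coeFn_compQuasiMeasurePreserving f
    (Measure.quasiMeasurePreserving_fst (μ := lebI) (ν := lebI))
  have h3 := AEEqFun.coeFn_compQuasiMeasurePreserving g
    (Measure.quasiMeasurePreserving_snd (μ := lebI) (ν := lebI))
  have e : ({p | s < |tensorI f g p|} : Set (ℝ × ℝ)) =ᵐ[lebI.prod lebI]
      {p | s < |g p.2 * f p.1|} := by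
    filter_upwards [h1, h2, h3] with p h1 h2 h3
    refine propext ?_
    change s < |tensorI f g p| ↔ s < |g p.2 * f p.1|
    rw [tensorI, h1, Pi.mul_apply, h2, h3, mul_comm]
    rfl
  have hm : MeasurableSet {p : ℝ × ℝ | s < |g p.2 * f p.1|} :=
    measurableSet_lt measurable_const
      ((g.stronglyMeasurable.measurable.comp measurable_snd).mul
        (f.stronglyMeasurable.measurable.comp measurable_fst)).abs
  rw [measure_congr e, Measure.prod_apply_symm hm]
  rfl

/-- By `prod_tensorI` the right side is the distribution function of the tensor product of `f` with
the step function. Both sides average over the two halves, which reduces to level `0`, where the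
step function is constant. -/
theorem lebI_levelSum (k : ℕ) (ξ : List Bool → ℝ) (f : L0I) (s : ℝ) :
    lebI {u | s < |levelSum k ξ f u|} =
      ∫⁻ v, lebI {u | s < |levelSum k ξ 1 v * f u|} ∂lebI := by
  have hH : Measurable fun r : ℝ => lebI {u | s < |r * f u|} := by
    have hm : MeasurableSet {p : ℝ × ℝ | s < |p.1 * f p.2|} :=
      measurableSet_lt measurable_const
        (measurable_fst.mul (f.stronglyMeasurable.measurable.comp measurable_snd)).abs
    exact measurable_measure_prodMk_left hm
  have hm : MeasurableSet {r : ℝ | s < |r|} := measurableSet_lt measurable_const measurable_id.abs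
  have hl : ∀ g : L0I, lebI {u | s < |g u|} =
      ∫⁻ t, {r : ℝ | s < |r|}.indicator 1 (g t) ∂lebI := fun g =>
    (lintegral_indicator_one (g.stronglyMeasurable.measurable hm)).symm
  induction k generalizing ξ with
  | zero =>
    have e : ∀ᵐ v ∂lebI, lebI {u | s < |levelSum 0 ξ 1 v * f u|} =
        lebI {u | s < |levelSum 0 ξ f u|} := by
      filter_upwards [AEEqFun.coeFn_smul (ξ []) (1 : L0I),
        AEEqFun.coeFn_one (α := ℝ) (μ := lebI) (β := ℝ)] with v h1 h2
      refine measure_congr ?_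
      filter_upwards [AEEqFun.coeFn_smul (ξ []) f] with u h3
      refine propext ?_
      change s < |levelSum 0 ξ 1 v * f u| ↔ s < |levelSum 0 ξ f u|
      simp [levelSum, h1, h2, h3]
    rw [lintegral_congr_ae e]
    simp
  | succ k ih =>
    rw [hl, levelSum, lintegral_dyadicJoin (measurable_one.indicator hm), ← hl, ← hl, ih, ih,
      levelSum, lintegral_dyadicJoin hH]

theorem equimeasurable_levelSum_rearrSq (k : ℕ) (ξ : List Bool → ℝ) (f : L0I) :
    Equimeasurable (levelSum k ξ f) (rearrSq (tensorI f (levelSum k ξ 1))) := by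
  intro s hs
  rw [lebI_rearrSq _ hs.le, prod_tensorI, lebI_levelSum]

theorem nrm_levelSum_one_lt_top (X : SymmetricSpace) (k : ℕ) (ξ : List Bool → ℝ) :
    X.nrm (levelSum k ξ 1) < ∞ := by
  refine (nrm_levelSum_le X k ξ 1).trans_lt ?_
  rw [X.nrm_one, mul_one]
  exact ENNReal.sum_lt_top.2 fun α _ => by simp

theorem nrm_levelSum_le_multNrm (X : SymmetricSpace) (k : ℕ) (ξ : List Bool → ℝ) {f : L0I}
    (hf : X.multNrm f < ∞) : X.nrm (levelSum k ξ f) ≤ X.multNrm f * X.xiNrm k ξ := by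
  have hfin := nrm_levelSum_one_lt_top X k ξ
  rw [X.symm _ _ (equimeasurable_levelSum_rearrSq k ξ f), X.xiNrm_eq]
  obtain ⟨C₀, hC₀, -⟩ := sInf_lt_iff.1 hf
  -- The product with the infimum equals the infimum of the products: finiteness of the second
  -- factor excludes `0 · ∞` at an infimum equal to `0`, and nonemptiness is needed when the second
  -- factor is `0`.
  have : Nonempty {C : ℝ≥0∞ | ∀ y : L0I, X.nrm y < ∞ → X.nrmSq (tensorI f y) ≤ C * X.nrm y} :=
    ⟨⟨C₀, hC₀⟩⟩
  rw [SymmetricSpace.multNrm, sInf_eq_iInf', ENNReal.iInf_mul fun h => absurd h hfin.ne]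
  exact le_iInf fun C => C.2 _ hfin

/-! ### Order continuity of the norm of a separable symmetric space -/

/-- The product of `x` and the characteristic function of `E`. -/
noncomputable def cut (x : L0I) (E : Set ℝ) (hE : MeasurableSet E) : L0I :=
  AEEqFun.mk (E.indicator x) (x.stronglyMeasurable.indicator hE).aestronglyMeasurable

theorem cut_ae (x : L0I) {E : Set ℝ} (hE : MeasurableSet E) :
    ∀ᵐ t ∂lebI, cut x E hE t = E.indicator x t := AEEqFun.coeFn_mk _ _

theorem SymmetricSpace.nrm_sub_comm (X : SymmetricSpace) (x y : L0I) :
    X.nrm (x - y) = X.nrm (y - x) := by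
  have h := X.nrm_smul (-1) (y - x)
  simpa using h

theorem SymmetricSpace.nrm_cut_le (X : SymmetricSpace) (x : L0I) {E : Set ℝ}
    (hE : MeasurableSet E) : X.nrm (cut x E hE) ≤ X.nrm x := by
  refine X.ideal _ _ ?_
  filter_upwards [cut_ae x hE] with t ht
  rw [ht]
  by_cases h : t ∈ E <;> simp [h]

/-- Otherwise there are disjoint sets `F k` with `‖x χ_{F k}‖ ≥ ε`. The functions `x χ_{G S}`, where
`G S` is the union of the `F k` with `k ∈ S ⊆ ℕ`, are then pairwise `ε`-separated, an uncountable
family that no separable space contains. -/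
theorem exists_index_nrm_cut_sub_lt (X : SymmetricSpace)
    (hX : TopologicalSpace.SeparableSpace X) {x : L0I} (hx : X.nrm x < ∞) {E : ℕ → Set ℝ}
    (hE : ∀ n, MeasurableSet (E n)) (hanti : Antitone E) {ε : ℝ≥0∞} (hε : 0 < ε) :
    ∃ N, ∀ n ≥ N, X.nrm (cut x (E N \ E n) ((hE N).diff (hE n))) < ε := by
  classical
  by_contra! hcon
  choose φ hφ1 hφ2 using hcon
  set N : ℕ → ℕ := fun k => φ^[k] 0 with hN
  have hNs : ∀ k, N (k + 1) = φ (N k) := fun k => Function.iterate_succ_apply' φ k 0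
  have hNmono : Monotone N := monotone_nat_of_le_succ fun k => by rw [hNs]; exact hφ1 _
  set F : ℕ → Set ℝ := fun k => E (N k) \ E (N (k + 1)) with hF
  have hFm : ∀ k, MeasurableSet (F k) := fun k => (hE _).diff (hE _)
  have hFn : ∀ k, ε ≤ X.nrm (cut x (F k) (hFm k)) := by
    intro k
    have := hφ2 (N k)
    simp only [← hNs] at this
    exact this
  have hFd : ∀ j k t, t ∈ F j → t ∈ F k → j = k := by
    intro j k t hj hk
    by_contra hne
    rcases lt_or_gt_of_ne hne with h | h
    · exact hj.2 (hanti (hNmono (Nat.succ_le_of_lt h)) hk.1)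
    · exact hk.2 (hanti (hNmono (Nat.succ_le_of_lt h)) hj.1)
  set G : Set ℕ → Set ℝ := fun S => ⋃ k ∈ S, F k with hG
  have hGm : ∀ S, MeasurableSet (G S) := fun S =>
    MeasurableSet.biUnion S.to_countable fun k _ => hFm k
  have hsep : ∀ S T : Set ℕ, ∀ k ∈ S, k ∉ T →
      ε ≤ X.nrm (cut x (G S) (hGm S) - cut x (G T) (hGm T)) := by
    intro S T k hS hT
    refine (hFn k).trans (X.ideal _ _ ?_)
    filter_upwards [cut_ae x (hFm k), cut_ae x (hGm S), cut_ae x (hGm T),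
      AEEqFun.coeFn_sub (cut x (G S) (hGm S)) (cut x (G T) (hGm T))] with t h1 h2 h3 h4
    rw [h1, h4, Pi.sub_apply, h2, h3]
    by_cases ht : t ∈ F k
    · have hGS : t ∈ G S := Set.mem_biUnion hS ht
      have hGT : t ∉ G T := by
        intro h
        obtain ⟨j, hj, htj⟩ := Set.mem_iUnion₂.1 h
        exact hT (hFd k j t ht htj ▸ hj)
      simp [ht, hGS, hGT]
    · simp [ht]
  set x' : Set ℕ → X := fun S => ⟨cut x (G S) (hGm S), (X.nrm_cut_le x _).trans_lt hx⟩ with hx'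
  -- The minimum with `1` keeps the radius finite when `ε = ∞`.
  have hε2 : 0 < min (ε / 2) 1 := lt_min (ENNReal.half_pos hε.ne') one_pos
  have hδ : 0 < (min (ε / 2) 1).toReal :=
    ENNReal.toReal_pos hε2.ne' (ne_top_of_le_ne_top ENNReal.one_ne_top (min_le_right _ _))
  -- Sending `S` to the index of a nearby term of the dense sequence would inject the subsets of `ℕ`
  -- into `ℕ`, against Cantor's theorem.
  have hdense := fun S => (TopologicalSpace.denseRange_denseSeq X).exists_dist_lt (x' S) hδ
  choose ι hι using hdense
  refine Function.cantor_injective ι fun S T hST => ?_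
  have hlt : ∀ S, X.nrm ((x' S).1 - (TopologicalSpace.denseSeq X (ι S)).1) < ε / 2 := by
    intro S
    have h := hι S
    rw [dist_eq_norm, SymmetricSpace.norm_def, ENNReal.toReal_lt_toReal
      (Subtype.prop (x' S - TopologicalSpace.denseSeq X (ι S))).ne
      (ne_top_of_le_ne_top ENNReal.one_ne_top (min_le_right _ _))] at h
    exact h.trans_le (min_le_left _ _)
  have hclose : X.nrm ((x' S).1 - (x' T).1) < ε := by
    have e : (x' S).1 - (x' T).1 = ((x' S).1 - (TopologicalSpace.denseSeq X (ι S)).1) +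
        ((TopologicalSpace.denseSeq X (ι T)).1 - (x' T).1) := by rw [hST]; abel
    rw [e]
    refine (X.nrm_add_le _ _).trans_lt ?_
    rw [X.nrm_sub_comm (TopologicalSpace.denseSeq X (ι T)).1]
    exact (ENNReal.add_lt_add (hlt S) (hlt T)).trans_eq (ENNReal.add_halves ε)
  by_contra hne
  obtain ⟨k, hk⟩ : ∃ k, ¬ (k ∈ S ↔ k ∈ T) := by
    by_contra! h
    exact hne (Set.ext h)
  by_cases hkS : k ∈ S
  · exact absurd hclose (not_lt.2 (hsep S T k hkS fun h => hk ⟨fun _ => h, fun _ => hkS⟩))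
  · have hkT : k ∈ T := by
      by_contra h
      exact hk ⟨fun h' => absurd h' hkS, fun h' => absurd h' h⟩
    rw [X.nrm_sub_comm] at hclose
    exact absurd hclose (not_lt.2 (hsep T S k hkT hkS))

/-- The differences `x χ_{E m} - x χ_{E n}` are small by the previous lemma, so the sequence
converges in `X`. Its limit vanishes off every `E m`, hence almost everywhere. -/
theorem tendsto_nrm_cut (X : SymmetricSpace) (hX : TopologicalSpace.SeparableSpace X) {x : L0I}
    (hx : X.nrm x < ∞) {E : ℕ → Set ℝ} (hE : ∀ n, MeasurableSet (E n)) (hanti : Antitone E)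
    (hnull : ∀ᵐ t ∂lebI, ∃ n, t ∉ E n) :
    Tendsto (fun n => X.nrm (cut x (E n) (hE n))) atTop (𝓝 0) := by
  have hsub : ∀ m n, m ≤ n → cut x (E m) (hE m) - cut x (E n) (hE n) =
      cut x (E m \ E n) ((hE m).diff (hE n)) := by
    intro m n hmn
    refine AEEqFun.ext ?_
    filter_upwards [cut_ae x (hE m), cut_ae x (hE n), cut_ae x ((hE m).diff (hE n)),
      AEEqFun.coeFn_sub (cut x (E m) (hE m)) (cut x (E n) (hE n))] with t h1 h2 h3 h4
    rw [h4, Pi.sub_apply, h1, h2, h3]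
    by_cases hn : t ∈ E n
    · simp [hn, hanti hmn hn]
    · by_cases hm : t ∈ E m <;> simp [hn, hm]
  have hcauchy : ∀ ε : ℝ≥0∞, 0 < ε → ∃ N, ∀ m ≥ N, ∀ n ≥ N,
      X.nrm (cut x (E m) (hE m) - cut x (E n) (hE n)) < ε := by
    intro ε hε
    obtain ⟨N, hN⟩ := exists_index_nrm_cut_sub_lt X hX hx hE hanti (ENNReal.half_pos hε.ne')
    refine ⟨N, fun m hm n hn => ?_⟩
    have e : cut x (E m) (hE m) - cut x (E n) (hE n) =
        (cut x (E m) (hE m) - cut x (E N) (hE N)) +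
          (cut x (E N) (hE N) - cut x (E n) (hE n)) := by abel
    rw [e]
    refine (X.nrm_add_le _ _).trans_lt ?_
    rw [X.nrm_sub_comm (cut x (E m) (hE m)), hsub N m hm, hsub N n hn]
    exact (ENNReal.add_lt_add (hN m hm) (hN n hn)).trans_eq (ENNReal.add_halves ε)
  obtain ⟨l, -, hlim⟩ := X.complete (fun n => cut x (E n) (hE n))
    (fun n => (X.nrm_cut_le x _).trans_lt hx) hcauchy
  have hl0 : ∀ m, cut l (E m)ᶜ (hE m).compl = 0 := by
    intro m
    refine X.eq_zero_of_nrm _ (le_antisymm (ge_of_tendsto hlim ?_) zero_le)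
    filter_upwards [eventually_ge_atTop m] with n hn
    refine X.ideal _ _ ?_
    filter_upwards [cut_ae l (hE m).compl, cut_ae x (hE n),
      AEEqFun.coeFn_sub (cut x (E n) (hE n)) l] with t h1 h2 h3
    rw [h1, h3, Pi.sub_apply, h2]
    by_cases hm : t ∈ E m
    · simp [hm]
    · have : t ∉ E n := fun h => hm (hanti hn h)
      simp [hm, this]
  have hl : l = 0 := by
    refine AEEqFun.ext ?_
    have h1 : ∀ᵐ t ∂lebI, ∀ m, (E m)ᶜ.indicator l t = 0 := by
      refine ae_all_iff.2 fun m => ?_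
      filter_upwards [cut_ae l (hE m).compl, AEEqFun.coeFn_zero (α := ℝ) (μ := lebI) (β := ℝ)]
        with t h1 h2
      rw [← h1, hl0, h2]; rfl
    filter_upwards [h1, hnull, AEEqFun.coeFn_zero (α := ℝ) (μ := lebI) (β := ℝ)] with t h1 h2 h3
    obtain ⟨n, hn⟩ := h2
    have := h1 n
    rw [Set.indicator_of_mem (show t ∈ (E n)ᶜ from hn)] at this
    rw [this, h3]; rfl
  simpa [hl] using hlim

/-- Dominated convergence in a separable symmetric space. -/
theorem tendsto_nrm_of_dominated (X : SymmetricSpace) (hX : TopologicalSpace.SeparableSpace X)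
    {x : L0I} (hx : X.nrm x < ∞) {u : ℕ → L0I} (hdom : ∀ n, ∀ᵐ t ∂lebI, |u n t| ≤ |x t|)
    (hlim : ∀ᵐ t ∂lebI, Tendsto (fun n => u n t) atTop (𝓝 0)) :
    Tendsto (fun n => X.nrm (u n)) atTop (𝓝 0) := by
  rw [ENNReal.tendsto_nhds_zero]
  intro ε hε
  obtain ⟨δ, hδ, hδε⟩ := ENNReal.lt_iff_exists_nnreal_btwn.1 (ENNReal.half_pos hε.ne')
  have hδ' : (0 : ℝ) < δ := by exact_mod_cast hδ
  -- As in Egorov's theorem: on `E n` the function `u n` is dominated by `x χ_{E n}`, whose norm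
  -- tends to zero; off `E n` it is at most `δ`, and `‖δ · 1‖ = δ < ε / 2`.
  set E : ℕ → Set ℝ := fun n => ⋃ m ≥ n, {t | (δ : ℝ) < |u m t|} with hE
  have hEm : ∀ n, MeasurableSet (E n) := fun n =>
    MeasurableSet.biUnion (Set.to_countable _) fun m _ =>
      measurableSet_lt measurable_const (u m).stronglyMeasurable.measurable.abs
  have hanti : Antitone E := fun m n hmn =>
    Set.biUnion_subset_biUnion_left fun k (hk : n ≤ k) => hmn.trans hk
  have hnull : ∀ᵐ t ∂lebI, ∃ n, t ∉ E n := by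
    filter_upwards [hlim] with t ht
    have h := ht.abs
    rw [abs_zero] at h
    obtain ⟨n, hn⟩ := eventually_atTop.1 (h.eventually_lt_const hδ')
    refine ⟨n, fun hmem => ?_⟩
    obtain ⟨m, hm, hmt⟩ := Set.mem_iUnion₂.1 hmem
    exact lt_asymm (hn m hm) hmt
  have hc := tendsto_nrm_cut X hX hx hEm hanti hnull
  filter_upwards [(ENNReal.tendsto_nhds_zero.1 hc) _ (ENNReal.half_pos hε.ne')] with n hn
  have e : u n = cut (u n) (E n) (hEm n) + cut (u n) (E n)ᶜ (hEm n).compl := by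
    refine AEEqFun.ext ?_
    filter_upwards [cut_ae (u n) (hEm n), cut_ae (u n) (hEm n).compl,
      AEEqFun.coeFn_add (cut (u n) (E n) (hEm n)) (cut (u n) (E n)ᶜ (hEm n).compl)] with t h1 h2 h3
    rw [h3, Pi.add_apply, h1, h2]
    by_cases h : t ∈ E n <;> simp [h]
  have h1 : X.nrm (cut (u n) (E n) (hEm n)) ≤ X.nrm (cut x (E n) (hEm n)) := by
    refine X.ideal _ _ ?_
    filter_upwards [cut_ae (u n) (hEm n), cut_ae x (hEm n), hdom n] with t h1 h2 h3
    rw [h1, h2]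
    by_cases h : t ∈ E n <;> simp [h, h3]
  have h2 : X.nrm (cut (u n) (E n)ᶜ (hEm n).compl) ≤ ε / 2 := by
    refine (X.ideal _ ((δ : ℝ) • 1) ?_).trans ?_
    · filter_upwards [cut_ae (u n) (hEm n).compl, AEEqFun.coeFn_smul (δ : ℝ) (1 : L0I),
        AEEqFun.coeFn_one (α := ℝ) (μ := lebI) (β := ℝ)] with t h1 h2 h3
      rw [h1, h2, Pi.smul_apply, h3]
      by_cases h : t ∈ E n
      · simp [h]
      · have hn : ¬ (δ : ℝ) < |u n t| := fun h' => h (Set.mem_biUnion (le_refl n) h')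
        simpa [h] using not_lt.1 hn
    · rw [X.nrm_smul, X.nrm_one, mul_one]
      simpa using hδε.le
  calc X.nrm (u n) ≤ _ := by conv_lhs => rw [e]
                             exact X.nrm_add_le _ _
    _ ≤ ε / 2 + ε / 2 := add_le_add (h1.trans hn) h2
    _ = ε := ENNReal.add_halves ε

/-- A uniformly bounded sequence that converges to zero in `L^p` converges to zero in the norm of
a separable symmetric space. -/
theorem tendsto_nrm_of_bounded (X : SymmetricSpace) (hX : TopologicalSpace.SeparableSpace X)
    {u : ℕ → L0I} {K : ℝ} (hK : ∀ n, ∀ᵐ t ∂lebI, |u n t| ≤ K) {p : ℝ≥0∞} (hp : p ≠ 0)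
    (hlim : Tendsto (fun n => eLpNorm (u n) p lebI) atTop (𝓝 0)) :
    Tendsto (fun n => X.nrm (u n)) atTop (𝓝 0) := by
  have hKx : X.nrm (K • (1 : L0I)) < ∞ := by
    rw [X.nrm_smul, X.nrm_one]; simp
  -- Every subsequence converges to zero in measure, hence almost everywhere along a further
  -- subsequence, where dominated convergence with the majorant `K` applies.
  refine tendsto_of_subseq_tendsto fun ns hns => ?_
  have hm : TendstoInMeasure lebI (fun n => (u (ns n) : ℝ → ℝ)) atTop (0 : ℝ → ℝ) := by
    refine tendstoInMeasure_of_tendsto_eLpNorm hp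
      (fun n => (u (ns n)).stronglyMeasurable.aestronglyMeasurable)
      aestronglyMeasurable_zero ?_
    simpa [Function.comp_def] using hlim.comp hns
  obtain ⟨ms, -, hae⟩ := hm.exists_seq_tendsto_ae
  refine ⟨ms, tendsto_nrm_of_dominated X hX hKx (u := fun n => u (ns (ms n))) (fun n => ?_) hae⟩
  filter_upwards [hK (ns (ms n)), AEEqFun.coeFn_smul K (1 : L0I),
    AEEqFun.coeFn_one (α := ℝ) (μ := lebI) (β := ℝ)] with t h1 h2 h3
  rw [h2, Pi.smul_apply, h3]
  simpa using h1.trans (le_abs_self K)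

/-! ### Density of dyadic step functions -/

theorem exists_levelSum_close (k : ℕ) {c : ℝ → ℝ} {ε : ℝ}
    (h : ∀ s ∈ Set.Icc (0 : ℝ) 1, ∀ t ∈ Set.Icc (0 : ℝ) 1, |s - t| ≤ (1 / 2) ^ k →
      |c s - c t| ≤ ε) :
    ∃ ξ : List Bool → ℝ, ∀ᵐ t ∂lebI, |levelSum k ξ 1 t - c t| ≤ ε := by
  induction k generalizing c with
  | zero =>
    refine ⟨fun _ => c 0, ?_⟩
    filter_upwards [show ∀ᵐ t ∂lebI, t ∈ Set.Icc (0 : ℝ) 1 from ae_restrict_mem measurableSet_Icc,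
      AEEqFun.coeFn_smul (c 0) (1 : L0I), AEEqFun.coeFn_one (α := ℝ) (μ := lebI) (β := ℝ)]
      with t ht h1 h2
    have := h 0 (by simp) t ht (by simpa [abs_of_nonneg ht.1] using ht.2)
    simpa [levelSum, h1, h2] using this
  | succ k ih =>
    set b : Bool → ℝ := fun a => if a then 1 else 0 with hb
    have hb0 : ∀ a, 0 ≤ b a ∧ b a ≤ 1 := fun a => by cases a <;> simp [hb]
    -- `t ↦ (t + b a) / 2` inverts `dyadicMap a`. It halves distances, so the condition at scale
    -- `2^{-(k+1)}` for `c` becomes the one at scale `2^{-k}` on each half.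
    have hstep : ∀ a : Bool, ∃ ξ : List Bool → ℝ,
        ∀ᵐ t ∂lebI, |levelSum k ξ 1 t - c ((t + b a) / 2)| ≤ ε := by
      intro a
      refine ih (c := fun t => c ((t + b a) / 2)) fun s hs t ht hst => ?_
      refine h _ ⟨?_, ?_⟩ _ ⟨?_, ?_⟩ ?_
      · linarith [hs.1, (hb0 a).1]
      · linarith [hs.2, (hb0 a).2]
      · linarith [ht.1, (hb0 a).1]
      · linarith [ht.2, (hb0 a).2]
      · rw [show (s + b a) / 2 - (t + b a) / 2 = (s - t) * (1 / 2) by ring, abs_mul, pow_succ,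
          abs_of_pos (show (0 : ℝ) < 1 / 2 by norm_num)]
        gcongr
    choose ζ hζ using hstep
    -- The default `false` plays no role: only words of length `k + 1` are used.
    refine ⟨fun α => ζ (α.headD false) α.tail, ae_lebI_of_forall_half fun a => ?_⟩
    filter_upwards [(quasiMeasurePreserving_dyadicMap a).ae (hζ a),
      dyadicJoin_ae_half (fun a => levelSum k (ζ a) 1) a] with t h1 h2
    have e : (dyadicMap a t + b a) / 2 = t := by simp only [dyadicMap, hb]; ring
    rw [e, ← h2] at h1
    exact h1

theorem integrable_of_bounded {u : L0I} {K : ℝ} (h : ∀ᵐ t ∂lebI, |u t| ≤ K) :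
    Integrable u lebI :=
  Integrable.of_bound u.stronglyMeasurable.aestronglyMeasurable K h

theorem exists_levelSum_near_of_bounded_L1 {h : L0I} {M : ℝ} (hM : 0 ≤ M)
    (hh : ∀ᵐ t ∂lebI, |h t| ≤ M) {ε : ℝ} (hε : 0 < ε) (hε1 : ε ≤ 1) :
    ∃ (k : ℕ) (ξ : List Bool → ℝ), (∀ᵐ t ∂lebI, |levelSum k ξ 1 t| ≤ M + 1) ∧
      eLpNorm (h - levelSum k ξ 1 : L0I) 1 lebI ≤ ENNReal.ofReal (2 * ε) := by
  have : lebI.WeaklyRegular := by unfold lebI; infer_instance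
  obtain ⟨g, hg, -⟩ := MemLp.exists_boundedContinuous_eLpNorm_sub_le ENNReal.one_ne_top
    (memLp_one_iff_integrable.2 (integrable_of_bounded hh))
    (ε := ENNReal.ofReal ε) (by simpa using hε)
  -- Truncating the continuous approximant to `[-M, M]` brings it no farther from `h` and makes the
  -- step functions bounded by `M + ε ≤ M + 1`.
  set c : ℝ → ℝ := fun t => max (-M) (min M (g t)) with hc
  have hcc : Continuous c := by fun_prop
  have hcM : ∀ t, |c t| ≤ M := fun t =>
    abs_le.2 ⟨le_max_left _ _, max_le (by linarith) (min_le_left _ _)⟩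
  have hcg : ∀ᵐ t ∂lebI, |h t - c t| ≤ |h t - g t| := by
    filter_upwards [hh] with t ht
    have h1 := abs_le.1 ht
    have e : h t = max (-M) (min M (h t)) := by
      rw [min_eq_right h1.2, max_eq_right h1.1]
    calc |h t - c t| = |max (-M) (min M (h t)) - max (-M) (min M (g t))| := by rw [← e]
      _ ≤ |min M (h t) - min M (g t)| := abs_max_sub_max_le_max _ _ _ _ |>.trans (by simp)
      _ ≤ |h t - g t| := abs_min_sub_min_le_max _ _ _ _ |>.trans (by simp)
  obtain ⟨δ, hδ, hunif⟩ := Metric.uniformContinuousOn_iff.1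
    (isCompact_Icc.uniformContinuousOn_of_continuous hcc.continuousOn) ε hε
  obtain ⟨k, hk⟩ := exists_pow_lt_of_lt_one hδ (show (1 / 2 : ℝ) < 1 by norm_num)
  obtain ⟨ξ, hξ⟩ := exists_levelSum_close k (c := c) (ε := ε) fun s hs t ht hst =>
    (hunif s hs t ht (hst.trans_lt hk)).le
  refine ⟨k, ξ, ?_, ?_⟩
  · filter_upwards [hξ] with t ht
    have := abs_sub_abs_le_abs_sub (levelSum k ξ 1 t) (c t)
    linarith [hcM t]
  · have hb : ∀ᵐ t ∂lebI, ‖(h - levelSum k ξ 1 : L0I) t‖ ≤ |h t - g t| + ε := by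
      filter_upwards [hcg, hξ, AEEqFun.coeFn_sub h (levelSum k ξ 1)] with t h1 h2 h3
      rw [h3, Pi.sub_apply, Real.norm_eq_abs]
      rw [abs_sub_comm] at h2
      exact (abs_sub_le _ (c t) _).trans (add_le_add h1 h2)
    have hgm : AEStronglyMeasurable (fun t => |h t - g t|) lebI :=
      (h.stronglyMeasurable.aestronglyMeasurable.sub
        g.continuous.aestronglyMeasurable).norm
    refine (eLpNorm_mono_ae_real hb).trans ((eLpNorm_add_le hgm aestronglyMeasurable_const
      le_rfl).trans ?_)
    rw [two_mul, ENNReal.ofReal_add hε.le hε.le]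
    refine add_le_add ?_ ?_
    · exact (eLpNorm_norm (μ := lebI) (p := 1) (fun t => h t - g t)).trans_le hg
    · rw [eLpNorm_const _ one_ne_zero (NeZero.ne lebI)]
      simp [Real.enorm_eq_ofReal hε.le]

/-- The approximants in `L¹` are uniformly bounded, so their convergence carries over to `X` by
`tendsto_nrm_of_bounded`. -/
theorem exists_levelSum_near_of_bounded (X : SymmetricSpace)
    (hX : TopologicalSpace.SeparableSpace X) {h : L0I} {M : ℝ} (hM : 0 ≤ M)
    (hh : ∀ᵐ t ∂lebI, |h t| ≤ M) {ε : ℝ} (hε : 0 < ε) :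
    ∃ (k : ℕ) (ξ : List Bool → ℝ), X.nrm (h - levelSum k ξ 1) < ENNReal.ofReal ε ∧
      |∫ t, h t ∂lebI - ∫ t, levelSum k ξ 1 t ∂lebI| < ε := by
  have hpos : ∀ n : ℕ, 0 < 1 / ((n : ℝ) + 1) := fun n => Nat.one_div_pos_of_nat
  choose k ξ hb hL using fun n : ℕ =>
    exists_levelSum_near_of_bounded_L1 hM hh (hpos n)
      (by rw [div_le_one (by positivity)]; linarith [n.cast_nonneg (α := ℝ)])
  have hto : Tendsto (fun n : ℕ => 2 * (1 / ((n : ℝ) + 1))) atTop (𝓝 0) := by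
    simpa using tendsto_one_div_add_atTop_nhds_zero_nat.const_mul (2 : ℝ)
  have hL0 : Tendsto (fun n => eLpNorm (h - levelSum (k n) (ξ n) 1 : L0I) 1 lebI) atTop (𝓝 0) := by
    refine tendsto_of_tendsto_of_tendsto_of_le_of_le tendsto_const_nhds
      (by simpa using ENNReal.tendsto_ofReal hto) (fun n => zero_le) hL
  have hX0 : Tendsto (fun n => X.nrm (h - levelSum (k n) (ξ n) 1)) atTop (𝓝 0) := by
    refine tendsto_nrm_of_bounded X hX (K := M + (M + 1)) (fun n => ?_) one_ne_zero hL0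
    filter_upwards [hh, hb n, AEEqFun.coeFn_sub h (levelSum (k n) (ξ n) 1)] with t h1 h2 h3
    rw [h3, Pi.sub_apply]
    exact (abs_sub _ _).trans (add_le_add h1 h2)
  have e1 := hX0.eventually_lt_const (ENNReal.ofReal_pos.2 hε)
  have e2 := hL0.eventually_lt_const (ENNReal.ofReal_pos.2 hε)
  obtain ⟨n, hn1, hn2⟩ := (e1.and e2).exists
  refine ⟨k n, ξ n, hn1, ?_⟩
  have i1 := integrable_of_bounded hh
  have i2 := integrable_of_bounded (hb n)
  rw [← integral_sub i1 i2, ← Real.norm_eq_abs]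
  have e3 : ∫ t, (h t - levelSum (k n) (ξ n) 1 t) ∂lebI =
      ∫ t, (h - levelSum (k n) (ξ n) 1 : L0I) t ∂lebI :=
    integral_congr_ae (AEEqFun.coeFn_sub h (levelSum (k n) (ξ n) 1)).symm
  rw [e3]
  refine lt_of_le_of_lt (norm_integral_le_lintegral_norm _) ?_
  rw [← ENNReal.lt_ofReal_iff_toReal_lt]
  · simpa [eLpNorm_one_eq_lintegral_enorm, Real.enorm_eq_ofReal_abs] using hn2
  · simpa [eLpNorm_one_eq_lintegral_enorm, Real.enorm_eq_ofReal_abs] using hn2.ne_top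

/-- The truncations of `x` to `{|x| ≤ n}` converge to `x` in `X`, and bounded functions are already
covered. One step function serves for norm and integral at once, as the ergodic theorem needs;
integrability is a separate premise, so the embedding of `X` into `L¹` is not invoked. -/
theorem exists_levelSum_near (X : SymmetricSpace) (hX : TopologicalSpace.SeparableSpace X)
    {x : L0I} (hx : X.nrm x < ∞) {ε : ℝ} (hε : 0 < ε) :
    ∃ (k : ℕ) (ξ : List Bool → ℝ), X.nrm (x - levelSum k ξ 1) < ENNReal.ofReal ε ∧
      (Integrable x lebI → |∫ t, x t ∂lebI - ∫ t, levelSum k ξ 1 t ∂lebI| < ε) := by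
  have hEm : ∀ n : ℕ, MeasurableSet {t | |x t| ≤ n} := fun n =>
    measurableSet_le x.stronglyMeasurable.measurable.abs measurable_const
  set u : ℕ → L0I := fun n => cut x _ (hEm n) with hu
  have hle : ∀ n, ∀ᵐ t ∂lebI, |u n t| ≤ |x t| := by
    intro n
    filter_upwards [cut_ae x (hEm n)] with t ht
    rw [ht]
    by_cases h : t ∈ {t | |x t| ≤ n} <;> simp only [h, Set.indicator_of_mem,
      Set.indicator_of_notMem, not_false_eq_true, le_refl, abs_zero, abs_nonneg]
  have hun : ∀ n : ℕ, ∀ᵐ t ∂lebI, |u n t| ≤ n := by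
    intro n
    filter_upwards [cut_ae x (hEm n)] with t ht
    rw [ht]
    by_cases h : t ∈ {t | |x t| ≤ n}
    · rw [Set.indicator_of_mem h]; exact h
    · rw [Set.indicator_of_notMem h]; simp
  have hev : ∀ᵐ t ∂lebI, ∀ᶠ n in atTop, u n t = x t := by
    have : ∀ᵐ t ∂lebI, ∀ n, u n t = {t | |x t| ≤ n}.indicator x t :=
      ae_all_iff.2 fun n => cut_ae x (hEm n)
    filter_upwards [this] with t ht
    obtain ⟨n, hn⟩ := exists_nat_ge |x t|
    filter_upwards [eventually_ge_atTop n] with m hm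
    rw [ht m, Set.indicator_of_mem]
    exact hn.trans (Nat.cast_le.2 hm)
  have h1 : Tendsto (fun n => X.nrm (x - u n)) atTop (𝓝 0) := by
    refine tendsto_nrm_of_dominated X hX hx (fun n => ?_) ?_
    · filter_upwards [cut_ae x (hEm n), AEEqFun.coeFn_sub x (u n)] with t h1 h2
      rw [h2, Pi.sub_apply, h1]
      by_cases h : t ∈ {t | |x t| ≤ n} <;> simp only [h, Set.indicator_of_mem,
        Set.indicator_of_notMem, not_false_eq_true, le_refl, abs_zero, abs_nonneg, sub_self,
        sub_zero]
    · have : ∀ᵐ t ∂lebI, ∀ n, (x - u n) t = x t - u n t :=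
        ae_all_iff.2 fun n => AEEqFun.coeFn_sub x (u n)
      filter_upwards [this, hev] with t h1 h2
      refine tendsto_const_nhds.congr' ?_
      filter_upwards [h2] with n hn
      rw [h1, hn, sub_self]
  have h2 : ∀ᶠ n in atTop, Integrable x lebI →
      |∫ t, x t ∂lebI - ∫ t, u n t ∂lebI| < ε / 2 := by
    by_cases hi : Integrable x lebI
    · have ht : Tendsto (fun n => ∫ t, u n t ∂lebI) atTop (𝓝 (∫ t, x t ∂lebI)) := by
        refine tendsto_integral_of_dominated_convergence (fun t => |x t|)
          (fun n => (u n).stronglyMeasurable.aestronglyMeasurable) hi.abs hle ?_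
        filter_upwards [hev] with t ht
        exact tendsto_const_nhds.congr' (ht.mono fun n hn => hn.symm)
      filter_upwards [Metric.tendsto_nhds.1 ht (ε / 2) (half_pos hε)] with n hn _
      rwa [dist_comm, Real.dist_eq] at hn
    · exact Eventually.of_forall fun n h => absurd h hi
  obtain ⟨n, hn1, hn2⟩ :=
    ((h1.eventually_lt_const (ENNReal.ofReal_pos.2 (half_pos hε))).and h2).exists
  obtain ⟨k, ξ, hk1, hk2⟩ :=
    exists_levelSum_near_of_bounded X hX n.cast_nonneg (hun n) (half_pos hε)
  refine ⟨k, ξ, ?_, fun hi => ?_⟩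
  · rw [show x - levelSum k ξ 1 = (x - u n) + (u n - levelSum k ξ 1) by abel]
    refine (X.nrm_add_le _ _).trans_lt ((ENNReal.add_lt_add hn1 hk1).trans_eq ?_)
    rw [← ENNReal.ofReal_add (half_pos hε).le (half_pos hε).le, add_halves]
  · have := abs_sub_le (∫ t, x t ∂lebI) (∫ t, u n t ∂lebI) (∫ t, levelSum k ξ 1 t ∂lebI)
    linarith [hn2 hi]

/-! ### Averages along the doubling map -/

theorem doubling_iterate_sum {ι : Type*} (j : ℕ) (s : Finset ι) (u : ι → L0I) :
    doubling^[j] (∑ i ∈ s, u i) = ∑ i ∈ s, doubling^[j] (u i) := by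
  classical
  induction s using Finset.induction_on with
  | empty => simpa using doubling_iterate_smul j 0 0
  | insert i s hi ih => rw [Finset.sum_insert hi, Finset.sum_insert hi, doubling_iterate_add, ih]

/-- `∑_{i < N} f(2^{mi} t mod 1)`. -/
noncomputable def doublingSum (m N : ℕ) (f : L0I) : L0I :=
  ∑ i ∈ Finset.range N, doubling^[m * i] f

theorem doublingSum_succ (m N : ℕ) (f : L0I) :
    doublingSum m (N + 1) f = f + doubling^[m] (doublingSum m N f) := by
  rw [doublingSum, Finset.sum_range_succ', doublingSum, doubling_iterate_sum, add_comm]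
  simp only [mul_zero, Function.iterate_zero, id_eq, mul_add, mul_one, add_comm _ m,
    Function.iterate_add_apply]

theorem doublingSum_add (m N : ℕ) (f g : L0I) :
    doublingSum m N (f + g) = doublingSum m N f + doublingSum m N g := by
  simp only [doublingSum, doubling_iterate_add, Finset.sum_add_distrib]

theorem doublingSum_smul_one (m N : ℕ) (c : ℝ) :
    doublingSum m N (c • 1) = ((N : ℝ) * c) • (1 : L0I) := by
  simp only [doublingSum, doubling_iterate_smul, doubling_iterate_one, Finset.sum_const,
    Finset.card_range, mul_smul, Nat.cast_smul_eq_nsmul]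

theorem nrm_doublingSum_le (X : SymmetricSpace) (m N : ℕ) (f : L0I) :
    X.nrm (doublingSum m N f) ≤ N * X.nrm f := by
  refine (Finset.le_sum_of_subadditive X.nrm X.nrm_zero.le X.nrm_add_le _ _).trans ?_
  simp [nrm_doubling_iterate]

theorem abs_doubling_iterate_le {f : L0I} {K : ℝ} (hf : ∀ᵐ t ∂lebI, |f t| ≤ K) (j : ℕ) :
    ∀ᵐ t ∂lebI, |(doubling^[j] f) t| ≤ K := by
  induction j with
  | zero => exact hf
  | succ j ih =>
    rw [Function.iterate_succ_apply']
    exact dyadicJoin_rel (r := fun x _ => |x| ≤ K) (v := fun _ => 0) fun _ => ih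

theorem abs_doublingSum_le {f : L0I} {K : ℝ} (hf : ∀ᵐ t ∂lebI, |f t| ≤ K) (m N : ℕ) :
    ∀ᵐ t ∂lebI, |doublingSum m N f t| ≤ N * K := by
  induction N with
  | zero =>
    filter_upwards [AEEqFun.coeFn_zero (α := ℝ) (μ := lebI) (β := ℝ)] with t ht
    simp [doublingSum, ht]
  | succ N ih =>
    rw [doublingSum_succ]
    filter_upwards [hf, abs_doubling_iterate_le ih m,
      AEEqFun.coeFn_add f (doubling^[m] (doublingSum m N f))] with t h1 h2 h3
    rw [h3, Pi.add_apply]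
    refine (abs_add_le _ _).trans ?_
    push_cast
    linarith

theorem integrable_mul_of_bounded {f g : L0I} {K L : ℝ} (hf : ∀ᵐ t ∂lebI, |f t| ≤ K)
    (hg : ∀ᵐ t ∂lebI, |g t| ≤ L) : Integrable (f * g : L0I) lebI := by
  refine integrable_of_bounded (K := K * L) ?_
  filter_upwards [hf, hg, AEEqFun.coeFn_mul f g] with t h1 h2 h3
  rw [h3, Pi.mul_apply, abs_mul]
  exact mul_le_mul h1 h2 (abs_nonneg _) ((abs_nonneg _).trans h1)

theorem integral_add_L0I {f g : L0I} (hf : Integrable f lebI) (hg : Integrable g lebI) :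
    ∫ t, (f + g : L0I) t ∂lebI = ∫ t, f t ∂lebI + ∫ t, g t ∂lebI := by
  rw [← integral_add hf hg]
  exact integral_congr_ae (AEEqFun.coeFn_add f g)

theorem add_mul_self_L0I (a b : L0I) :
    (a + b) * (a + b) = (a * a + (a * b + a * b)) + b * b := by
  induction a using AEEqFun.induction_on with | _ a ha
  induction b using AEEqFun.induction_on with | _ b hb
  simp only [AEEqFun.mk_add_mk, AEEqFun.mk_mul_mk]
  congr 1
  ring

/-- Orthogonality of the iterates: a mean-zero step function of level `k` depends on the first `k`
digits only, and `T^{k+1}` of anything depends on later digits. The gap `k + 1` instead of `k` keeps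
it positive for `k = 0`. -/
theorem integral_doublingSum_mul_self {k : ℕ} {ξ : List Bool → ℝ} {K : ℝ}
    (hK : ∀ᵐ t ∂lebI, |levelSum k ξ 1 t| ≤ K) (h0 : ∫ t, levelSum k ξ 1 t ∂lebI = 0) (N : ℕ) :
    ∫ t, (doublingSum (k + 1) N (levelSum k ξ 1) * doublingSum (k + 1) N (levelSum k ξ 1) : L0I) t
      ∂lebI = N * ∫ t, (levelSum k ξ 1 * levelSum k ξ 1 : L0I) t ∂lebI := by
  induction N with
  | zero =>
    have e : ∀ᵐ t ∂lebI, (doublingSum (k + 1) 0 (levelSum k ξ 1) *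
        doublingSum (k + 1) 0 (levelSum k ξ 1) : L0I) t = 0 := by
      filter_upwards [AEEqFun.coeFn_mul (doublingSum (k + 1) 0 (levelSum k ξ 1))
        (doublingSum (k + 1) 0 (levelSum k ξ 1)), abs_doublingSum_le hK (k + 1) 0] with t h1 h2
      rw [Nat.cast_zero, zero_mul] at h2
      rw [h1, Pi.mul_apply, abs_nonpos_iff.1 h2, zero_mul]
    rw [integral_congr_ae e]
    simp
  | succ N ih =>
    set h := levelSum k ξ 1 with hh
    set s := doublingSum (k + 1) N h with hs
    have hsb := abs_doublingSum_le hK (k + 1) N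
    have hSb := abs_doubling_iterate_le hsb (k + 1)
    have i1 := integrable_mul_of_bounded hK hK
    have i2 := integrable_mul_of_bounded hK hSb
    have i3 := integrable_mul_of_bounded hSb hSb
    have e : doublingSum (k + 1) (N + 1) h * doublingSum (k + 1) (N + 1) h =
        (h * h + (h * doubling^[k + 1] s + h * doubling^[k + 1] s)) +
          doubling^[k + 1] s * doubling^[k + 1] s := by
      rw [doublingSum_succ, ← hs]; exact add_mul_self_L0I _ _
    have e2 : ∫ t, (h * doubling^[k + 1] s : L0I) t ∂lebI = 0 := by
      have hi : Integrable (doubling s) lebI :=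
        integrable_of_bounded (abs_doubling_iterate_le hsb 1)
      -- With `T^{k+1} s = T^k (T s)`, the product is `levelSum k ξ (T s)`, whose integral is `(∫
      -- h)(∫ T s)`.
      rw [Function.iterate_succ_apply, hh, levelSum_one_mul, integral_levelSum k ξ hi, h0, zero_mul]
    have e3 : ∫ t, (doubling^[k + 1] s * doubling^[k + 1] s : L0I) t ∂lebI =
        ∫ t, (s * s : L0I) t ∂lebI := by
      rw [← doubling_iterate_mul, integral_doubling_iterate _ (integrable_mul_of_bounded hsb hsb)]
    have i22 : Integrable (h * doubling^[k + 1] s + h * doubling^[k + 1] s : L0I) lebI :=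
      (i2.add i2).congr (AEEqFun.coeFn_add _ _).symm
    have i12 : Integrable (h * h + (h * doubling^[k + 1] s + h * doubling^[k + 1] s) : L0I) lebI :=
      (i1.add i22).congr (AEEqFun.coeFn_add _ _).symm
    rw [e, integral_add_L0I i12 i3, integral_add_L0I i1 i22, integral_add_L0I i2 i2, e2, e3, ih]
    push_cast
    ring

/-- By orthogonality the average has `L²` norm `(c / N)^{1/2}`; it is also uniformly bounded, so it
tends to zero in `X`. -/
theorem tendsto_nrm_average_of_integral_eq_zero (X : SymmetricSpace)
    (hX : TopologicalSpace.SeparableSpace X) {k : ℕ} {ξ : List Bool → ℝ} {K : ℝ}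
    (hK : ∀ᵐ t ∂lebI, |levelSum k ξ 1 t| ≤ K) (h0 : ∫ t, levelSum k ξ 1 t ∂lebI = 0) :
    Tendsto (fun N : ℕ => X.nrm ((N : ℝ)⁻¹ • doublingSum (k + 1) N (levelSum k ξ 1)))
      atTop (𝓝 0) := by
  have hbound : ∀ N : ℕ, ∀ᵐ t ∂lebI,
      |((N : ℝ)⁻¹ • doublingSum (k + 1) N (levelSum k ξ 1)) t| ≤ |K| := by
    intro N
    filter_upwards [abs_doublingSum_le hK (k + 1) N,
      AEEqFun.coeFn_smul (N : ℝ)⁻¹ (doublingSum (k + 1) N (levelSum k ξ 1))] with t h1 h2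
    rw [h2, Pi.smul_apply, smul_eq_mul, abs_mul, abs_of_nonneg (by positivity)]
    rcases Nat.eq_zero_or_pos N with rfl | hN
    · simp
    · have : (0 : ℝ) < N := by exact_mod_cast hN
      calc (N : ℝ)⁻¹ * _ ≤ (N : ℝ)⁻¹ * (N * K) := by gcongr
        _ = K := by field_simp
        _ ≤ |K| := le_abs_self K
  refine tendsto_nrm_of_bounded X hX hbound two_ne_zero ?_
  set c := ∫ t, (levelSum k ξ 1 * levelSum k ξ 1 : L0I) t ∂lebI
  have he : ∀ N : ℕ, eLpNorm ((N : ℝ)⁻¹ • doublingSum (k + 1) N (levelSum k ξ 1) : L0I) 2 lebI =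
      ENNReal.ofReal (((N : ℝ)⁻¹ * c) ^ (1 / 2 : ℝ)) := by
    intro N
    set s := doublingSum (k + 1) N (levelSum k ξ 1) with hs
    have hmem : MemLp ((N : ℝ)⁻¹ • s : L0I) 2 lebI :=
      MemLp.of_bound (AEEqFun.aestronglyMeasurable _) |K| (hbound N)
    rw [hmem.eLpNorm_eq_integral_rpow_norm two_ne_zero ENNReal.ofNat_ne_top]
    have e1 : ∀ᵐ t ∂lebI, ‖((N : ℝ)⁻¹ • s : L0I) t‖ ^ (2 : ℝ≥0∞).toReal =
        ((N : ℝ)⁻¹) ^ 2 * (s * s : L0I) t := by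
      filter_upwards [AEEqFun.coeFn_smul (N : ℝ)⁻¹ s, AEEqFun.coeFn_mul s s] with t h1 h2
      rw [h1, h2]
      simp only [Pi.smul_apply, smul_eq_mul, Pi.mul_apply, ENNReal.toReal_ofNat, Real.rpow_ofNat,
        Real.norm_eq_abs, sq_abs]
      ring
    rw [integral_congr_ae e1, integral_const_mul, integral_doublingSum_mul_self hK h0]
    rcases Nat.eq_zero_or_pos N with rfl | hN
    · simp
    · have : (N : ℝ) ≠ 0 := by positivity
      congr 2
      · field_simp
        rfl
      · simp
  simp only [he]
  have h1 : Tendsto (fun N : ℕ => ((N : ℝ)⁻¹ * c) ^ (1 / 2 : ℝ)) atTop (𝓝 0) := by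
    have := (tendsto_inv_atTop_nhds_zero_nat (𝕜 := ℝ)).mul_const c
    rw [zero_mul] at this
    simpa using this.rpow_const (p := 1 / 2) (Or.inr (by norm_num))
  simpa using ENNReal.tendsto_ofReal h1

theorem levelSum_one_bounded (k : ℕ) (ξ : List Bool → ℝ) :
    ∃ K : ℝ, ∀ᵐ t ∂lebI, |levelSum k ξ 1 t| ≤ K := by
  set K := ∑ α : List.Vector Bool k, |ξ α.1|
  refine ⟨K, ?_⟩
  have h := abs_levelSum_le (k := k) (ξ := ξ) (η := fun _ => K) (fun α hα => by
    refine le_trans ?_ (le_abs_self K)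
    exact Finset.single_le_sum (f := fun α : List.Vector Bool k => |ξ α.1|)
      (fun _ _ => abs_nonneg _) (Finset.mem_univ ⟨α, hα⟩)) 1
  filter_upwards [h, AEEqFun.coeFn_smul K (1 : L0I),
    AEEqFun.coeFn_one (α := ℝ) (μ := lebI) (β := ℝ)] with t h1 h2 h3
  rw [levelSum_const, doubling_iterate_one, h2, Pi.smul_apply, h3] at h1
  have hK : 0 ≤ K := Finset.sum_nonneg fun _ _ => abs_nonneg _
  simpa [abs_of_nonneg hK] using h1

/-- A step function `h` with mean `c` replaces `f`. The three errors are the average of `f - h`,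
which is no larger in norm than `f - h` because `T` preserves the norm, the average of `h - c`, and
`c - ∫ f`. -/
theorem exists_nrm_average_sub_lt (X : SymmetricSpace) (hX : TopologicalSpace.SeparableSpace X)
    {f : L0I} (hf : X.nrm f < ∞) (hfi : Integrable f lebI) {ε : ℝ} (hε : 0 < ε) :
    ∃ m N : ℕ, 0 < m ∧ 0 < N ∧
      X.nrm ((N : ℝ)⁻¹ • doublingSum m N f - (∫ t, f t ∂lebI) • 1) < ENNReal.ofReal ε := by
  have hε3 : 0 < ε / 3 := by positivity
  obtain ⟨k, ξ, h1, h2⟩ := exists_levelSum_near X hX hf hε3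
  set h := levelSum k ξ 1 with hh
  set c := ∫ t, h t ∂lebI with hc
  have e0 : levelSum k (ξ + fun _ => -c) 1 = h + (-c) • 1 := by
    rw [levelSum_add_left, levelSum_const, doubling_iterate_one]
  have hmean : ∫ t, levelSum k (ξ + fun _ => -c) 1 t ∂lebI = 0 := by
    have i2 : Integrable ((-c) • 1 : L0I) lebI :=
      (integrable_one_L0I.smul (-c)).congr (AEEqFun.coeFn_smul (-c) 1).symm
    rw [e0, integral_add_L0I (integrable_levelSum k ξ integrable_one_L0I) i2,
      integral_congr_ae (AEEqFun.coeFn_smul (-c) (1 : L0I))]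
    simp only [Pi.smul_apply, integral_smul, integral_one_L0I]
    simp [← hc, ← hh]
  obtain ⟨K, hK⟩ := levelSum_one_bounded k (ξ + fun _ => -c)
  have hlim := tendsto_nrm_average_of_integral_eq_zero X hX hK hmean
  obtain ⟨N, hN1, hN⟩ := ((hlim.eventually_lt_const (ENNReal.ofReal_pos.2 hε3)).and
    (eventually_gt_atTop 0)).exists
  refine ⟨k + 1, N, k.succ_pos, hN, ?_⟩
  rw [e0] at hN1
  have hN0 : (N : ℝ) ≠ 0 := by positivity
  have key : (N : ℝ)⁻¹ • doublingSum (k + 1) N f - (∫ t, f t ∂lebI) • (1 : L0I) =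
      ((N : ℝ)⁻¹ • doublingSum (k + 1) N (f - h) +
        (N : ℝ)⁻¹ • doublingSum (k + 1) N (h + (-c) • 1)) + (c - ∫ t, f t ∂lebI) • 1 := by
    have e1 : f = (f - h) + ((h + (-c) • 1) + c • 1) := by
      rw [neg_smul]; abel
    conv_lhs => rw [e1]
    rw [doublingSum_add, doublingSum_add _ _ (h + (-c) • 1), doublingSum_smul_one, ← e1, smul_add,
      smul_add, smul_smul, inv_mul_cancel_left₀ hN0, sub_smul]
    abel
  have t1 : X.nrm ((N : ℝ)⁻¹ • doublingSum (k + 1) N (f - h)) < ENNReal.ofReal (ε / 3) := by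
    refine lt_of_le_of_lt ?_ h1
    rw [X.nrm_smul]
    refine (mul_le_mul_right (nrm_doublingSum_le X (k + 1) N (f - h)) _).trans ?_
    rw [← mul_assoc, enorm_inv hN0, Real.enorm_natCast,
      ENNReal.inv_mul_cancel (by simpa using hN.ne')
      (by simp), one_mul]
  have t2 : X.nrm ((c - ∫ t, f t ∂lebI) • 1) < ENNReal.ofReal (ε / 3) := by
    rw [X.nrm_smul, X.nrm_one, mul_one, Real.enorm_eq_ofReal_abs, abs_sub_comm]
    exact (ENNReal.ofReal_lt_ofReal_iff hε3).2 (h2 hfi)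
  rw [key]
  refine (X.nrm_add_le _ _).trans_lt ?_
  refine (ENNReal.add_lt_add ((X.nrm_add_le _ _).trans_lt (ENNReal.add_lt_add t1 hN1))
    t2).trans_eq ?_
  rw [← ENNReal.ofReal_add hε3.le hε3.le, ← ENNReal.ofReal_add (by positivity) hε3.le]
  congr 1; ring

/-! ### The sequence space `Ξ` -/

/-- The multi-indices with length in `S`. -/
noncomputable def levels (S : Finset ℕ) : Finset (List Bool) :=
  S.biUnion fun k => (Finset.univ : Finset (List.Vector Bool k)).image fun α => α.1

theorem mem_levels {S : Finset ℕ} {α : List Bool} : α ∈ levels S ↔ α.length ∈ S := by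
  simp only [levels, Finset.mem_biUnion, Finset.mem_image, Finset.mem_univ, true_and]
  constructor
  · rintro ⟨k, hk, v, rfl⟩
    rwa [v.2]
  · exact fun h => ⟨_, h, ⟨α, rfl⟩, rfl⟩

theorem sum_levels {M : Type*} [AddCommMonoid M] (S : Finset ℕ) (g : List Bool → M) :
    ∑ α ∈ levels S, g α = ∑ k ∈ S, ∑ α : List.Vector Bool k, g α.1 := by
  rw [levels, Finset.sum_biUnion]
  · exact Finset.sum_congr rfl fun k _ => Finset.sum_image fun a _ b _ h => Subtype.ext h
  · intro j _ k _ hjk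
    refine Finset.disjoint_left.2 fun α hα hα' => hjk ?_
    obtain ⟨v, -, rfl⟩ := Finset.mem_image.1 hα
    obtain ⟨w, -, hw⟩ := Finset.mem_image.1 hα'
    rw [← v.2, ← w.2, hw]

namespace SymmetricSpace

variable (X : SymmetricSpace)

theorem xiNrm_smul (k : ℕ) (c : ℝ) (ξ : List Bool → ℝ) :
    X.xiNrm k (c • ξ) = ‖c‖ₑ * X.xiNrm k ξ := by
  rw [xiNrm_eq, xiNrm_eq, levelSum_smul_left, X.nrm_smul]

theorem xiNrm_add_le (k : ℕ) (ξ η : List Bool → ℝ) :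
    X.xiNrm k (ξ + η) ≤ X.xiNrm k ξ + X.xiNrm k η := by
  rw [xiNrm_eq, xiNrm_eq, xiNrm_eq, levelSum_add_left]
  exact X.nrm_add_le _ _

theorem xiNrm_mono {k : ℕ} {ξ η : List Bool → ℝ} (h : ∀ α, α.length = k → |ξ α| ≤ |η α|) :
    X.xiNrm k ξ ≤ X.xiNrm k η := by
  rw [xiNrm_eq, xiNrm_eq]
  exact X.ideal _ _ (abs_levelSum_le h 1)

theorem xiNrm_congr {k : ℕ} {ξ η : List Bool → ℝ} (h : ∀ α, α.length = k → ξ α = η α) :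
    X.xiNrm k ξ = X.xiNrm k η := by
  rw [xiNrm_eq, xiNrm_eq, levelSum_congr h]

theorem xiNrm_zero (k : ℕ) : X.xiNrm k 0 = 0 := by
  simpa using X.xiNrm_smul k 0 0

theorem xiNrm_le_sum (k : ℕ) (ξ : List Bool → ℝ) :
    X.xiNrm k ξ ≤ ∑ α : List.Vector Bool k, ‖ξ α.1‖ₑ := by
  rw [xiNrm_eq]
  simpa [X.nrm_one] using nrm_levelSum_le X k ξ 1

theorem nrm_dyadicPow_one_ne_zero (α : List Bool) : X.nrm (dyadicPow α 1) ≠ 0 := by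
  intro h
  have h1 := X.nrm_one
  rw [dyadicPow_eq_zero (X.eq_zero_of_nrm _ h), X.nrm_zero] at h1
  exact zero_ne_one h1

/-- Dropping all coordinates but one does not increase the norm. As `V^α 1 ≠ 0`, the coordinate
functionals are continuous on `Ξ`. -/
theorem enorm_mul_le_xiNrm (α : List Bool) (ξ : List Bool → ℝ) :
    ‖ξ α‖ₑ * X.nrm (dyadicPow α 1) ≤ X.xiNrm α.length ξ := by
  have h : levelSum α.length (Pi.single α (ξ α)) 1 = ξ α • dyadicPow α 1 := by
    refine (levelSum_eq_sum _ _ _).trans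
      ((Finset.sum_eq_single (⟨α, rfl⟩ : List.Vector Bool α.length) ?_ ?_).trans ?_)
    · intro β _ hβ
      rw [Pi.single_eq_of_ne fun h => hβ (Subtype.ext h), zero_smul]
    · exact fun h => absurd (Finset.mem_univ (α := List.Vector Bool α.length) _) h
    · rw [Pi.single_eq_same]
  rw [← X.nrm_smul, ← h, ← xiNrm_eq]
  refine X.xiNrm_mono fun β _ => ?_
  by_cases hb : β = α
  · subst hb; simp
  · simp [Pi.single_eq_of_ne hb]

theorem xiSumNrm_smul (c : ℝ) (ξ : List Bool → ℝ) :
    X.xiSumNrm (c • ξ) = ‖c‖ₑ * X.xiSumNrm ξ := by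
  simp only [xiSumNrm, xiNrm_smul, ENNReal.tsum_mul_left]

theorem xiSumNrm_add_le (ξ η : List Bool → ℝ) :
    X.xiSumNrm (ξ + η) ≤ X.xiSumNrm ξ + X.xiSumNrm η := by
  rw [xiSumNrm, xiSumNrm, xiSumNrm, ← ENNReal.tsum_add]
  exact ENNReal.tsum_le_tsum fun k => X.xiNrm_add_le k ξ η

theorem enorm_mul_le_xiSumNrm (α : List Bool) (ξ : List Bool → ℝ) :
    ‖ξ α‖ₑ * X.nrm (dyadicPow α 1) ≤ X.xiSumNrm ξ :=
  (X.enorm_mul_le_xiNrm α ξ).trans (ENNReal.le_tsum α.length)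

theorem xiSumNrm_eq_zero {ξ : List Bool → ℝ} (h : X.xiSumNrm ξ = 0) : ξ = 0 := by
  funext α
  have h1 := X.enorm_mul_le_xiSumNrm α ξ
  rw [h, nonpos_iff_eq_zero, mul_eq_zero] at h1
  simpa using h1.resolve_right (X.nrm_dyadicPow_one_ne_zero α)

theorem xiSumNrm_eq_sum {S : Finset ℕ} {ξ : List Bool → ℝ}
    (h : ∀ α, α.length ∉ S → ξ α = 0) : X.xiSumNrm ξ = ∑ k ∈ S, X.xiNrm k ξ :=
  tsum_eq_sum fun k hk => by
    rw [X.xiNrm_congr (η := 0) fun α hα => h α (by rwa [hα]), X.xiNrm_zero]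

/-- The tail of the `ℓ¹`-sum bounds all families dominated by `ξ` simultaneously. This uniformity
makes the basis property independent of the enumeration. -/
theorem exists_levels_xiSumNrm_le {ξ : List Bool → ℝ} (hξ : X.xiSumNrm ξ < ∞) {ε : ℝ≥0∞}
    (hε : 0 < ε) : ∃ S : Finset ℕ, ∀ η : List Bool → ℝ, (∀ α, |η α| ≤ |ξ α|) →
      (∀ α ∈ levels S, η α = 0) → X.xiSumNrm η ≤ ε := by
  obtain ⟨S, hS⟩ := ((ENNReal.tendsto_nhds_zero.1
    (ENNReal.tendsto_tsum_compl_atTop_zero hξ.ne)) ε hε).exists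
  refine ⟨S, fun η h1 h2 => le_trans ?_
    ((tsum_subtype {k | k ∉ S} fun k => X.xiNrm k ξ).ge.trans hS)⟩
  refine ENNReal.tsum_le_tsum fun k => ?_
  by_cases hk : k ∈ S
  · rw [X.xiNrm_congr (η := 0) fun α hα => h2 α (mem_levels.2 (by rwa [hα])), X.xiNrm_zero]
    exact zero_le
  · rw [Set.indicator_of_mem (show k ∈ {k | k ∉ S} from hk)]
    exact X.xiNrm_mono fun α _ => h1 α

theorem xiSumNrm_complete (U : ℕ → List Bool → ℝ) (hU : ∀ n, X.xiSumNrm (U n) < ∞)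
    (hcauchy : ∀ ε : ℝ≥0∞, 0 < ε → ∃ N, ∀ m ≥ N, ∀ n ≥ N, X.xiSumNrm (U m - U n) < ε) :
    ∃ l, X.xiSumNrm l < ∞ ∧ Tendsto (fun n => X.xiSumNrm (U n - l)) atTop (𝓝 0) := by
  have hcoord : ∀ α, ∃ r, Tendsto (fun n => U n α) atTop (𝓝 r) := by
    intro α
    refine cauchySeq_tendsto_of_complete (Metric.cauchySeq_iff.2 fun ε hε => ?_)
    obtain ⟨N, hN⟩ := hcauchy (ENNReal.ofReal ε * X.nrm (dyadicPow α 1))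
      (ENNReal.mul_pos (ENNReal.ofReal_pos.2 hε).ne' (X.nrm_dyadicPow_one_ne_zero α))
    refine ⟨N, fun m hm n hn => ?_⟩
    have h := (X.enorm_mul_le_xiSumNrm α (U m - U n)).trans_lt (hN m hm n hn)
    have h2 : ‖(U m - U n) α‖ₑ < ENNReal.ofReal ε := by
      by_contra h'
      exact absurd h (not_lt.2 (mul_le_mul_left (not_lt.1 h') _))
    rw [Real.enorm_eq_ofReal_abs, ENNReal.ofReal_lt_ofReal_iff hε] at h2
    rwa [Real.dist_eq]
  choose l hl using hcoord
  have hclose : ∀ ε : ℝ≥0∞, 0 < ε → ∃ N, ∀ n ≥ N, X.xiSumNrm (U n - l) ≤ ε := by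
    intro ε hε
    obtain ⟨N, hN⟩ := hcauchy ε hε
    -- Only finitely many levels are considered at a time; there coordinatewise convergence `U m →
    -- l` is norm convergence, and `m → ∞` is harmless.
    refine ⟨N, fun n hn => ENNReal.tsum_le_of_sum_range_le fun K => ?_⟩
    have hlim : Tendsto (fun m => ε + ∑ k ∈ Finset.range K, ∑ α : List.Vector Bool k,
        ‖(U m - l) α.1‖ₑ) atTop (𝓝 (ε + ∑ k ∈ Finset.range K, ∑ α : List.Vector Bool k, 0)) := by
      refine tendsto_const_nhds.add (tendsto_finsetSum _ fun k _ =>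
        tendsto_finsetSum _ fun α _ => ?_)
      have := ((hl α.1).sub_const (l α.1)).enorm
      simpa using this
    simp only [Finset.sum_const_zero, add_zero] at hlim
    refine ge_of_tendsto hlim ?_
    filter_upwards [eventually_ge_atTop N] with m hm
    calc ∑ k ∈ Finset.range K, X.xiNrm k (U n - l)
        ≤ ∑ k ∈ Finset.range K, (X.xiNrm k (U n - U m) + X.xiNrm k (U m - l)) := by
          refine Finset.sum_le_sum fun k _ => ?_
          rw [show U n - l = (U n - U m) + (U m - l) by abel]
          exact X.xiNrm_add_le k _ _
      _ = ∑ k ∈ Finset.range K, X.xiNrm k (U n - U m) +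
          ∑ k ∈ Finset.range K, X.xiNrm k (U m - l) := Finset.sum_add_distrib
      _ ≤ _ := by
          refine add_le_add ?_ (Finset.sum_le_sum fun k _ => X.xiNrm_le_sum k _)
          exact (ENNReal.sum_le_tsum _).trans (hN n hn m hm).le
  refine ⟨l, ?_, ENNReal.tendsto_nhds_zero.2 fun ε hε => ?_⟩
  · obtain ⟨N, hN⟩ := hclose 1 one_pos
    have e : l = U N + (-1 : ℝ) • (U N - l) := by simp
    rw [e]
    refine (X.xiSumNrm_add_le _ _).trans_lt (ENNReal.add_lt_top.2 ⟨hU N, ?_⟩)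
    rw [xiSumNrm_smul]
    simpa using (hN N le_rfl).trans_lt ENNReal.one_lt_top
  · obtain ⟨N, hN⟩ := hclose ε hε
    filter_upwards [eventually_ge_atTop N] with n hn using hN n hn

theorem isBasicSequenceSpace_xiSeqNrm (e : ℕ ≃ List Bool) :
    IsBasicSequenceSpace (X.xiSeqNrm e) where
  eq_zero_of_nrm ξ h := by
    funext n
    simpa using congrFun (X.xiSumNrm_eq_zero h) (e n)
  nrm_smul c ξ := X.xiSumNrm_smul c _
  nrm_add_le ξ η := X.xiSumNrm_add_le _ _
  complete u hu hc := by
    obtain ⟨l, hl, hlim⟩ := X.xiSumNrm_complete (fun n α => u n (e.symm α)) hu hc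
    refine ⟨fun n => l (e n), ?_, ?_⟩
    · simpa [xiSeqNrm] using hl
    · refine hlim.congr fun n => ?_
      rw [xiSeqNrm]
      congr 1
      funext α
      simp
  unit_mem n := by
    rw [xiSeqNrm, X.xiSumNrm_eq_sum (S := {(e n).length})]
    · rw [Finset.sum_singleton]
      exact (X.xiNrm_le_sum _ _).trans_lt (ENNReal.sum_lt_top.2 fun α _ => by simp)
    · intro α hα
      refine Pi.single_eq_of_ne (fun h => hα ?_) 1
      simp [← h]
  basis ξ hξ c := by
    have hval : ∀ N m, (ξ - ∑ n ∈ Finset.range N, c n • Pi.single (M := fun _ => ℝ) n 1) m =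
        ξ m - if m < N then c m else 0 := by
      intro N m
      simp [Finset.sum_apply, Pi.single_apply]
    constructor
    · intro h
      funext m
      have h1 : ∀ᶠ N in atTop, ‖ξ m - c m‖ₑ * X.nrm (dyadicPow (e m) 1) ≤
          X.xiSeqNrm e (ξ - ∑ n ∈ Finset.range N, c n • Pi.single n 1) := by
        filter_upwards [eventually_gt_atTop m] with N hN
        refine le_trans (le_of_eq ?_) (X.enorm_mul_le_xiSumNrm (e m) _)
        rw [e.symm_apply_apply, hval, if_pos hN]
      have h2 := ge_of_tendsto h h1
      rw [nonpos_iff_eq_zero, mul_eq_zero] at h2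
      have h3 := h2.resolve_right (X.nrm_dyadicPow_one_ne_zero _)
      rw [enorm_eq_zero, sub_eq_zero] at h3
      exact h3.symm
    · rintro rfl
      refine ENNReal.tendsto_nhds_zero.2 fun ε hε => ?_
      obtain ⟨S, hS⟩ := X.exists_levels_xiSumNrm_le hξ hε
      -- Beyond this index all words with length in `S` have been enumerated, so the remainder of
      -- `ξ` vanishes on them.
      filter_upwards [eventually_gt_atTop ((levels S).sup e.symm)] with N hN
      refine hS _ (fun α => ?_) fun α hα => ?_
      · rw [hval]
        split_ifs <;> simp
      · rw [hval, if_pos (lt_of_le_of_lt (Finset.le_sup (f := e.symm) hα) hN), sub_self]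

/-! ### Frame bounds -/

/-- `∑_{|α| = k} ξ_α V^α f` as an element of `X`. -/
noncomputable def levelElem (k : ℕ) (ξ : List Bool → ℝ) (f : X) : X :=
  ∑ α : List.Vector Bool k, ξ α.1 • X.dyadicElem f α.1

theorem coe_levelElem (k : ℕ) (ξ : List Bool → ℝ) (f : X) :
    (X.levelElem k ξ f).1 = levelSum k ξ f.1 := by
  rw [levelElem, levelSum_eq_sum, AddSubmonoidClass.coe_finsetSum]
  rfl

theorem norm_levelElem_le {f : X} (hf : X.multNrm f.1 < ∞) (k : ℕ) (ξ : List Bool → ℝ) :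
    ENNReal.ofReal ‖X.levelElem k ξ f‖ ≤ X.multNrm f.1 * X.xiNrm k ξ := by
  rw [ofReal_norm_eq, coe_levelElem]
  exact nrm_levelSum_le_multNrm X k ξ hf

/-- Multiplying each coefficient by the sign of its term makes the sum equal to `y` of a single
element of `X`, and does not increase the norm in `Ξ_k`. -/
theorem sum_enorm_le {f : X} (hf : X.multNrm f.1 < ∞) (y : StrongDual ℝ X) (k : ℕ)
    (ξ : List Bool → ℝ) : ∑ α : List.Vector Bool k, ‖ξ α.1 * y (X.dyadicElem f α.1)‖ₑ ≤
      ENNReal.ofReal ((X.multNrm f.1).toReal * ‖y‖) * X.xiNrm k ξ := by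
  set σ : List Bool → ℝ := fun α => SignType.sign (ξ α * y (X.dyadicElem f α)) * ξ α with hσ
  have h1 : ∀ α, |σ α| ≤ |ξ α| := by
    intro α
    rw [hσ, abs_mul]
    refine mul_le_of_le_one_left (abs_nonneg _) ?_
    rcases SignType.sign (ξ α * y (X.dyadicElem f α)) with _ | _ | _ <;> simp
  have h2 : y (X.levelElem k σ f) =
      ∑ α : List.Vector Bool k, |ξ α.1 * y (X.dyadicElem f α.1)| := by
    rw [levelElem, map_sum]
    refine Finset.sum_congr rfl fun α _ => ?_
    rw [map_smul, smul_eq_mul, hσ, mul_assoc, sign_mul_self]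
  have h3 : ∑ α : List.Vector Bool k, ‖ξ α.1 * y (X.dyadicElem f α.1)‖ₑ =
      ENNReal.ofReal (y (X.levelElem k σ f)) := by
    rw [h2, ENNReal.ofReal_sum_of_nonneg fun _ _ => abs_nonneg _]
    exact Finset.sum_congr rfl fun α _ => Real.enorm_eq_ofReal_abs _
  rw [h3]
  calc ENNReal.ofReal (y (X.levelElem k σ f)) ≤ ENNReal.ofReal (‖y‖ * ‖X.levelElem k σ f‖) :=
        ENNReal.ofReal_le_ofReal ((le_abs_self _).trans (y.le_opNorm _))
    _ = ENNReal.ofReal ‖y‖ * ENNReal.ofReal ‖X.levelElem k σ f‖ :=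
        ENNReal.ofReal_mul (norm_nonneg _)
    _ ≤ ENNReal.ofReal ‖y‖ * (X.multNrm f.1 * X.xiNrm k ξ) := by
        gcongr
        refine (X.norm_levelElem_le hf k σ).trans ?_
        gcongr
        exact X.xiNrm_mono fun α _ => h1 α
    _ = ENNReal.ofReal ((X.multNrm f.1).toReal * ‖y‖) * X.xiNrm k ξ := by
        rw [ENNReal.ofReal_mul ENNReal.toReal_nonneg, ENNReal.ofReal_toReal hf.ne]
        ring

theorem seqDualNrm_le {f : X} (hf : X.multNrm f.1 < ∞) (e : ℕ ≃ List Bool)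
    (y : StrongDual ℝ X) : seqDualNrm (X.xiSeqNrm e) (fun n => y (X.dyadicElem f (e n))) ≤
      ENNReal.ofReal ((X.multNrm f.1).toReal * ‖y‖) := by
  refine sInf_le fun ξ hξ => ?_
  set B := ENNReal.ofReal ((X.multNrm f.1).toReal * ‖y‖) with hB
  have h1 : ∑' n, ‖ξ n * y (X.dyadicElem f (e n))‖ₑ ≤ B := by
    rw [← e.symm.tsum_eq, ENNReal.tsum_eq_iSup_sum]
    refine iSup_le fun T => ?_
    calc _ ≤ ∑ α ∈ levels (T.image List.length),
          ‖ξ (e.symm α) * y (X.dyadicElem f (e (e.symm α)))‖ₑ :=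
          Finset.sum_le_sum_of_subset fun α hα =>
            mem_levels.2 (Finset.mem_image_of_mem _ hα)
      _ ≤ ∑ k ∈ T.image List.length, B * X.xiNrm k (fun α => ξ (e.symm α)) := by
          rw [sum_levels]
          simp only [e.apply_symm_apply]
          exact Finset.sum_le_sum fun k _ => X.sum_enorm_le hf y k fun α => ξ (e.symm α)
      _ ≤ B * X.xiSumNrm (fun α => ξ (e.symm α)) := by
          rw [← Finset.mul_sum]
          gcongr
          exact ENNReal.sum_le_tsum _
      _ ≤ B * 1 := by gcongr; exact hξ
      _ = B := mul_one B
  have hs : Summable fun n => ξ n * y (X.dyadicElem f (e n)) :=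
    Summable.of_enorm (ne_top_of_le_ne_top ENNReal.ofReal_ne_top h1)
  exact ⟨_, hs.hasSum.tendsto_sum_nat, enorm_tsum_le_tsum_enorm.trans h1⟩

/-- The bound is tested on `ζ` restricted to the levels in `S`; the resulting series has finitely
many nonzero terms, so its value does not depend on `e`. -/
theorem enorm_sum_levelElem_le {f : X} {e : ℕ ≃ List Bool} {y : StrongDual ℝ X} {C : ℝ≥0∞}
    (hC : ∀ ξ, X.xiSeqNrm e ξ ≤ 1 → ∃ l : ℝ, Tendsto (fun N => ∑ n ∈ Finset.range N,
      ξ n * y (X.dyadicElem f (e n))) atTop (𝓝 l) ∧ ‖l‖ₑ ≤ C)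
    (S : Finset ℕ) {ζ : List Bool → ℝ} (hζ : ∑ k ∈ S, X.xiNrm k ζ ≤ 1) :
    ‖∑ k ∈ S, y (X.levelElem k ζ f)‖ₑ ≤ C := by
  set η : List Bool → ℝ := fun α => if α.length ∈ S then ζ α else 0 with hη
  have hη1 : X.xiSeqNrm e (fun n => η (e n)) ≤ 1 := by
    rw [xiSeqNrm]
    simp only [e.apply_symm_apply]
    rw [X.xiSumNrm_eq_sum (S := S) fun α hα => if_neg hα]
    refine le_trans (Finset.sum_le_sum fun k hk => le_of_eq (X.xiNrm_congr fun α hα => ?_)) hζ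
    exact if_pos (by rwa [hα])
  obtain ⟨l, hl, hlC⟩ := hC _ hη1
  have hsum : HasSum (fun α => η α * y (X.dyadicElem f α))
      (∑ α ∈ levels S, η α * y (X.dyadicElem f α)) := by
    refine hasSum_sum_of_ne_finset_zero fun α hα => ?_
    rw [mem_levels] at hα
    rw [hη]
    simp [hα]
  have hl' := tendsto_nhds_unique hl (e.hasSum_iff.2 hsum).tendsto_sum_nat
  have hval : ∑ α ∈ levels S, η α * y (X.dyadicElem f α) = ∑ k ∈ S, y (X.levelElem k ζ f) := by
    rw [sum_levels]
    refine Finset.sum_congr rfl fun k hk => ?_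
    rw [levelElem, map_sum]
    refine Finset.sum_congr rfl fun α _ => ?_
    have : η α.1 = ζ α.1 := if_pos (by rwa [α.2])
    rw [this, map_smul, smul_eq_mul]
  rwa [← hval, ← hl']

/-- The constant function `1` as an element of `X`. -/
noncomputable def oneElem : X := ⟨1, by
  change X.nrm 1 < ∞
  rw [X.nrm_one]
  exact ENNReal.one_lt_top⟩

theorem abs_integral_mul_levelElem_le (hX : TopologicalSpace.SeparableSpace X) {f : X}
    (hfi : Integrable f.1 lebI) {e : ℕ ≃ List Bool} {y : StrongDual ℝ X} {C : ℝ} (hC0 : 0 ≤ C)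
    (hC : ∀ ξ, X.xiSeqNrm e ξ ≤ 1 → ∃ l : ℝ, Tendsto (fun N => ∑ n ∈ Finset.range N,
      ξ n * y (X.dyadicElem f (e n))) atTop (𝓝 l) ∧ ‖l‖ₑ ≤ ENNReal.ofReal C)
    {k : ℕ} {ξ : List Bool → ℝ} (hξ : X.xiNrm k ξ ≤ 1) :
    |∫ t, f.1 t ∂lebI| * |y (X.levelElem k ξ X.oneElem)| ≤ C := by
  set c := ∫ t, f.1 t ∂lebI with hc
  set K := (∑ α : List.Vector Bool k, ‖ξ α.1‖ₑ).toReal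
  have hKtop : ∑ α : List.Vector Bool k, ‖ξ α.1‖ₑ ≠ ∞ :=
    (ENNReal.sum_lt_top.2 fun α _ => by simp).ne
  -- `K` depends on `ξ` but not on `ε`, so the error disappears as `ε → 0`.
  have main : ∀ ε : ℝ, 0 < ε → |c| * |y (X.levelElem k ξ X.oneElem)| ≤ C + ‖y‖ * (K * ε) := by
    intro ε hε
    obtain ⟨m, N, hm, hN, hlt⟩ := exists_nrm_average_sub_lt X hX f.2 hfi hε
    have hN0 : (N : ℝ) ≠ 0 := by positivity
    -- At each level `mi + k` this family represents `N⁻¹ g`, where `g = levelSum k ξ 1`. The levels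
    -- are distinct because `m > 0`.
    set ζ : List Bool → ℝ := (N : ℝ)⁻¹ • fun α => ξ (α.take k) with hζ
    have hinj : Set.InjOn (fun i => m * i + k) (Finset.range N) := by
      intro i _ j _ hij
      exact Nat.eq_of_mul_eq_mul_left hm (Nat.add_right_cancel hij)
    have hlev : ∀ (i : ℕ) (g : L0I), levelSum (m * i + k) ζ g =
        (N : ℝ)⁻¹ • levelSum k ξ (doubling^[m * i] g) := by
      intro i g
      rw [hζ, levelSum_smul_left, levelSum_take]
    have hsum : ∑ j ∈ (Finset.range N).image (fun i => m * i + k), X.xiNrm j ζ ≤ 1 := by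
      rw [Finset.sum_image hinj]
      calc ∑ i ∈ Finset.range N, X.xiNrm (m * i + k) ζ
          ≤ ∑ _i ∈ Finset.range N, (N : ℝ≥0∞)⁻¹ := by
            refine Finset.sum_le_sum fun i _ => ?_
            rw [xiNrm_eq, hlev, X.nrm_smul, doubling_iterate_one, ← xiNrm_eq, enorm_inv hN0,
              Real.enorm_natCast]
            exact mul_le_of_le_one_right' hξ
        _ = 1 := by
            rw [Finset.sum_const, Finset.card_range, nsmul_eq_mul]
            exact ENNReal.mul_inv_cancel (by simpa using hN.ne') (by simp)
    have hbound := X.enorm_sum_levelElem_le hC _ hsum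
    rw [Finset.sum_image hinj, ← map_sum] at hbound
    set z : X := ∑ i ∈ Finset.range N, X.levelElem (m * i + k) ζ f with hz
    have hz1 : z.1 = levelSum k ξ ((N : ℝ)⁻¹ • doublingSum m N f.1) := by
      have hs : ∀ (s : Finset ℕ) (u : ℕ → L0I),
          levelSum k ξ (∑ i ∈ s, u i) = ∑ i ∈ s, levelSum k ξ (u i) := by
        intro s u
        induction s using Finset.induction_on with
        | empty => simpa using levelSum_smul_right k ξ 0 0
        | insert i s hi ih => rw [Finset.sum_insert hi, Finset.sum_insert hi,
            levelSum_add_right, ih]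
      rw [hz, AddSubmonoidClass.coe_finsetSum, levelSum_smul_right, doublingSum, hs,
        Finset.smul_sum]
      exact Finset.sum_congr rfl fun i _ => by rw [coe_levelElem, hlev]
    have hdiff : ‖z - c • X.levelElem k ξ X.oneElem‖ ≤ K * ε := by
      have e1 : (z - c • X.levelElem k ξ X.oneElem).1 =
          levelSum k ξ ((N : ℝ)⁻¹ • doublingSum m N f.1 - c • 1) := by
        rw [sub_eq_add_neg ((N : ℝ)⁻¹ • _), ← neg_smul, levelSum_add_right, ← hz1,
          levelSum_smul_right, neg_smul, ← sub_eq_add_neg]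
        change z.1 - c • (X.levelElem k ξ X.oneElem).1 = _
        rw [coe_levelElem]
        rfl
      rw [norm_def, e1]
      refine ENNReal.toReal_le_of_le_ofReal (by positivity) ?_
      rw [ENNReal.ofReal_mul ENNReal.toReal_nonneg, ENNReal.ofReal_toReal hKtop]
      refine (nrm_levelSum_le X k ξ _).trans ?_
      gcongr
    have hz2 : |y z| ≤ C := by
      rwa [Real.enorm_eq_ofReal_abs, ENNReal.ofReal_le_ofReal_iff hC0] at hbound
    calc |c| * |y (X.levelElem k ξ X.oneElem)| = |y (c • X.levelElem k ξ X.oneElem)| := by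
          rw [map_smul, smul_eq_mul, abs_mul]
      _ = |y z - y (z - c • X.levelElem k ξ X.oneElem)| := by rw [map_sub, sub_sub_cancel]
      _ ≤ |y z| + |y (z - c • X.levelElem k ξ X.oneElem)| := abs_sub _ _
      _ ≤ C + ‖y‖ * (K * ε) := by
          refine add_le_add hz2 ((y.le_opNorm _).trans ?_)
          gcongr
  have hlim : Tendsto (fun ε : ℝ => C + ‖y‖ * (K * ε)) (𝓝[>] 0) (𝓝 C) := by
    have : Continuous fun ε : ℝ => C + ‖y‖ * (K * ε) := by fun_prop
    simpa using (this.tendsto 0).mono_left nhdsWithin_le_nhds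
  exact ge_of_tendsto hlim (eventually_mem_nhdsWithin.mono fun ε hε => main ε hε)

theorem abs_integral_mul_norm_le (hX : TopologicalSpace.SeparableSpace X) {f : X}
    (hfi : Integrable f.1 lebI) {e : ℕ ≃ List Bool} {y : StrongDual ℝ X} {C : ℝ} (hC0 : 0 ≤ C)
    (hC : ∀ ξ, X.xiSeqNrm e ξ ≤ 1 → ∃ l : ℝ, Tendsto (fun N => ∑ n ∈ Finset.range N,
      ξ n * y (X.dyadicElem f (e n))) atTop (𝓝 l) ∧ ‖l‖ₑ ≤ ENNReal.ofReal C) :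
    |∫ t, f.1 t ∂lebI| * ‖y‖ ≤ C := by
  set c := ∫ t, f.1 t ∂lebI with hc
  have hball : ∀ x : X, ‖x‖ < 1 → ‖(c • y) x‖ ≤ C := by
    intro x hx
    -- In the open unit ball there is room for a step function within `δ` of `x` whose norm is still
    -- at most `1`.
    have main : ∀ δ : ℝ, 0 < δ → δ ≤ 1 - ‖x‖ → ‖(c • y) x‖ ≤ C + ‖c • y‖ * δ := by
      intro δ hδ hδx
      obtain ⟨k, ξ, hkξ, -⟩ := exists_levelSum_near X hX x.2 hδ
      set G := X.levelElem k ξ X.oneElem with hG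
      have hG1 : G.1 = levelSum k ξ 1 := X.coe_levelElem k ξ X.oneElem
      have hxG : ‖x - G‖ ≤ δ := by
        rw [norm_def]
        refine ENNReal.toReal_le_of_le_ofReal hδ.le ?_
        change X.nrm (x.1 - G.1) ≤ _
        rw [hG1]
        exact hkξ.le
      have hGn : X.xiNrm k ξ ≤ 1 := by
        rw [xiNrm_eq, ← hG1, ← ofReal_norm_eq, ENNReal.ofReal_le_one]
        have := norm_sub_le x (x - G)
        rw [sub_sub_cancel] at this
        linarith
      have h1 := X.abs_integral_mul_levelElem_le hX hfi hC0 hC hGn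
      calc ‖(c • y) x‖ = ‖(c • y) G + (c • y) (x - G)‖ := by rw [← map_add, add_sub_cancel]
        _ ≤ ‖(c • y) G‖ + ‖(c • y) (x - G)‖ := norm_add_le _ _
        _ ≤ C + ‖c • y‖ * δ := by
            refine add_le_add ?_ (((c • y).le_opNorm _).trans (by gcongr))
            rw [_root_.smul_apply, norm_smul]
            exact h1
    have hlim : Tendsto (fun δ : ℝ => C + ‖c • y‖ * δ) (𝓝[>] 0) (𝓝 C) := by
      have : Continuous fun δ : ℝ => C + ‖c • y‖ * δ := by fun_prop
      simpa using (this.tendsto 0).mono_left nhdsWithin_le_nhds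
    refine ge_of_tendsto hlim ?_
    filter_upwards [Ioc_mem_nhdsGT (sub_pos.2 hx)] with δ hδ using main δ hδ.1 hδ.2
  have h : ‖c • y‖ ≤ C := by
    rw [← (c • y).sSup_unit_ball_eq_norm]
    refine csSup_le ((Metric.nonempty_ball.2 one_pos).image _) ?_
    rintro _ ⟨x, hx, rfl⟩
    exact hball x (by simpa using hx)
  rwa [norm_smul, Real.norm_eq_abs] at h

theorem le_seqDualNrm (hX : TopologicalSpace.SeparableSpace X) {f : X}
    (hfi : Integrable f.1 lebI) (e : ℕ ≃ List Bool) (y : StrongDual ℝ X) :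
    ENNReal.ofReal (|∫ t, f.1 t ∂lebI| * ‖y‖) ≤
      seqDualNrm (X.xiSeqNrm e) (fun n => y (X.dyadicElem f (e n))) := by
  refine le_sInf fun C hC => ?_
  rcases eq_or_ne C ∞ with rfl | hCtop
  · exact le_top
  · refine ENNReal.ofReal_le_of_le_toReal
      (X.abs_integral_mul_norm_le hX hfi (e := e) ENNReal.toReal_nonneg ?_)
    rwa [ENNReal.ofReal_toReal hCtop]

end SymmetricSpace

/-! ### The frame theorem. -/

/-- Frame theorem for dyadic dilations and translations in a separable symmetric space. The
enumeration `e` of the multi-indices is arbitrary. -/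
theorem theoremt1 (X : SymmetricSpace) (hX : TopologicalSpace.SeparableSpace X) (f : X)
    (hint : ∫ t, f.1 t ∂lebI ≠ 0) (hf : f.1 ∈ X.multiplicator) (e : ℕ ≃ List Bool) :
    IsFrame (X.xiSeqNrm e) (fun n => X.dyadicElem f (e n)) ∧
    IsFrameWithBounds (X.xiSeqNrm e) (fun n => X.dyadicElem f (e n))
      |∫ t, f.1 t ∂lebI| (X.multNrm f.1).toReal := by
  -- The integral of a non-integrable function is `0` by convention, so a nonzero integral forces
  -- integrability.
  have hfi : Integrable f.1 lebI := by
    by_contra h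
    exact hint (integral_undef h)
  have hf0 : f.1 ≠ 0 := by
    intro h
    refine hint ?_
    rw [h, integral_congr_ae AEEqFun.coeFn_zero]
    simp
  have hlow := fun y => X.le_seqDualNrm hX hfi e y
  have hup := fun y => X.seqDualNrm_le hf e y
  have hframe : IsFrameWithBounds (X.xiSeqNrm e) (fun n => X.dyadicElem f (e n))
      |∫ t, f.1 t ∂lebI| (X.multNrm f.1).toReal :=
    { basic := X.isBasicSequenceSpace_xiSeqNrm e
      ne_zero := fun n h => hf0 (dyadicPow_eq_zero (congrArg Subtype.val h))
      pos := abs_pos.2 hint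
      le := by
        -- `A ≤ B` follows by comparing the two frame inequalities at one functional of norm `1`,
        -- which exists since `X ≠ 0`.
        have hone : X.oneElem ≠ 0 := by
          intro h
          have h1 := X.nrm_one
          rw [show (1 : L0I) = 0 from congrArg Subtype.val h, X.nrm_zero] at h1
          exact zero_ne_one h1
        obtain ⟨y, hy, -⟩ := exists_dual_vector ℝ X.oneElem (norm_ne_zero_iff.2 hone)
        have h := (hlow y).trans (hup y)
        rw [hy, mul_one, mul_one] at h
        exact (ENNReal.ofReal_le_ofReal_iff ENNReal.toReal_nonneg).1 h
      lower := hlow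
      upper := hup }
  exact ⟨⟨_, _, hframe⟩, hframe⟩
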